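/- Let $d\ge 1$. Call a smooth, integrable function $g\colon[0,\infty)\to(0,\infty)$ a generator if $\frac{\pi^{d/2}}{\Gamma(d/2)}\int_0^\infty r^{d/2-1}g(r)\,dr=1$, $\int_0^\infty r^{(d-1)/2}g(r)\,dr<\infty$ and $\int_0^\infty r^{d/2}g(r)\,dr<\infty$. For $m\in\mathbb R^d$ and a symmetric positive definite $\Sigma\in\mathbb R^{d\times d}$, write $\mu\sim E(m,\Sigma,g)$ if $\mu$ has Lebesgue density $p_{m,\Sigma,g}(x)=\det(\Sigma)^{-1/2}g\big((x-m)^{T}\Sigma^{-1}(x-m)\big)$, and put $\kappa_g=\frac1d\int_{\mathbb R^d}\|y\|^2g(\|y\|^2)\,dy$. For $\mu,\nu$ in the elliptic family with generator $g$, a (Wasserstein) dual geodesic from $\mu$ to $\nu$ in this family is a curve $\rho_t=p_{m_t,\Sigma_t,g}$, $t\in[0,1]$, with $m_t\in\mathbb R^d$ and $\Sigma_t$ (symmetric positive definite) depending smoothly on $t$, such that $\rho_0,\rho_1$ are the densities of $\mu,\nu$ and there is a time-independent potential $f\in C^\infty(\mathbb R^d)$ with $\partial_t\rho_t=-\nabla\cdot(\rho_t\nabla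 f)$ on $[0,1]\times\mathbb R^d$. The WKL divergence is $$D^{\mathrm{WKL}}(\mu\mid\nu)=\inf\int_0^1 t\int_{\mathbb R^d}\|\nabla f(x)\|^2\rho_t(x)\,dx\,dt\in[0,\infty],$$ the infimum being taken over all such dual geodesics $\rho$ and potentials $f$. Theorem. Let $\mu\sim E(m_0,\Sigma_0,g)$, $\nu\sim E(m_1,\Sigma_1,g)$ and $\Delta m=m_1-m_0$. For a symmetric matrix $A$ let $A^\dagger$ be its Moore–Penrose inverse and $A^\perp=I-AA^\dagger$ the orthogonal projection onto its kernel; $\log$ and $\sqrt{\cdot}$ are the usual functions of symmetric positive (semi)definite matrices. Set $$R=\Sigma_0^{-1/2}\big(\Sigma_0^{1/2}\Sigma_1\Sigma_0^{1/2}\big)^{1/2}\Sigma_0^{-1/2},\qquad Q=(R-I)^\dagger\big(\log(R^2)R^2-R^2+I\big)(R-I)^\dagger .$$ Then $D^{\mathrm{WKL}}(\mu\mid\nu)$ is finite and $$D^{\mathrm{WKL}}(\mu\mid\nu)=\frac{\kappa_g}{4}\operatorname{tr}\big(\Sigma_0-\Sigma_1+\Sigma_0R^2\log(R^2)\big)+\frac14\Big\|\sqrt{Q+2\log(R)^\perp}\,\Delta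 m\Big\|^2 .$$ If moreover $\Sigma_0\Sigma_1=\Sigma_1\Sigma_0$, then $$D^{\mathrm{WKL}}(\mu\mid\nu)=\frac{\kappa_g}{4}\Big\|\sqrt{Q}\big(\sqrt{\Sigma_1}-\sqrt{\Sigma_0}\big)\Big\|_F^2+\frac14\Big\|\sqrt{Q+2\log(R)^\perp}\,\Delta m\Big\|^2 .$$ -/

import Mathlib

open MeasureTheory
open scoped ENNReal ContDiff Gradient Matrix

noncomputable section

namespace WKL

/-! ### Matrix functions -/

/-- Square root of a symmetric positive semidefinite matrix. -/
def sqrtm {d : ℕ} (A : Matrix (Fin d) (Fin d) ℝ) : Matrix (Fin d) (Fin d) ℝ :=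
  cfc Real.sqrt A

/-- Principal logarithm of a symmetric positive definite matrix. -/
def logm {d : ℕ} (A : Matrix (Fin d) (Fin d) ℝ) : Matrix (Fin d) (Fin d) ℝ :=
  cfc Real.log A

/-- Moore–Penrose pseudo-inverse of a symmetric matrix: nonzero eigenvalues are inverted and the
eigenvalue zero is kept (recall `0⁻¹ = 0`). See `pinv_penrose`. -/
def pinv {d : ℕ} (A : Matrix (Fin d) (Fin d) ℝ) : Matrix (Fin d) (Fin d) ℝ :=
  cfc (fun x : ℝ => x⁻¹) A

/-- The four Penrose equations, which characterize the Moore–Penrose inverse. -/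
theorem pinv_penrose {d : ℕ} (A : Matrix (Fin d) (Fin d) ℝ) (hA : A.IsHermitian) :
    A * pinv A * A = A ∧ pinv A * A * pinv A = pinv A ∧
      (A * pinv A)ᵀ = A * pinv A ∧ (pinv A * A)ᵀ = pinv A * A := by
  have hs : IsSelfAdjoint A := hA
  have hfin : (spectrum ℝ A).Finite := A.finite_real_spectrum
  have hc : ∀ f : ℝ → ℝ, ContinuousOn f (spectrum ℝ A) := fun f => hfin.continuousOn f
  have hid : cfc (fun x : ℝ => x) A = A := cfc_id' ℝ A
  have h1 : A * pinv A = cfc (fun x : ℝ => x * x⁻¹) A := by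
    rw [cfc_mul (fun x : ℝ => x) (fun x : ℝ => x⁻¹) A (hc _) (hc _), hid, pinv]
  have h2 : pinv A * A = cfc (fun x : ℝ => x * x⁻¹) A := by
    have : (fun x : ℝ => x * x⁻¹) = fun x : ℝ => x⁻¹ * x := by
      funext x; exact mul_comm _ _
    rw [this, cfc_mul (fun x : ℝ => x⁻¹) (fun x : ℝ => x) A (hc _) (hc _), hid, pinv]
  have h3 : (cfc (fun x : ℝ => x * x⁻¹) A)ᵀ = cfc (fun x : ℝ => x * x⁻¹) A := by
    have h := (cfc_predicate (fun x : ℝ => x * x⁻¹) A).star_eq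
    rwa [Matrix.star_eq_conjTranspose, Matrix.conjTranspose_eq_transpose_of_trivial] at h
  refine ⟨?_, ?_, ?_, ?_⟩
  · rw [h1]
    calc cfc (fun x : ℝ => x * x⁻¹) A * A
        = cfc (fun x : ℝ => x * x⁻¹) A * cfc (fun x : ℝ => x) A := by rw [hid]
      _ = cfc (fun x : ℝ => x * x⁻¹ * x) A := by
          rw [← cfc_mul (fun x : ℝ => x * x⁻¹) (fun x : ℝ => x) A (hc _) (hc _)]
      _ = cfc (fun x : ℝ => x) A := by
          congr 1
          funext x
          exact mul_inv_mul_cancel x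
      _ = A := hid
  · rw [h2, pinv, ← cfc_mul (fun x : ℝ => x * x⁻¹) (fun x : ℝ => x⁻¹) A (hc _) (hc _)]
    congr 1
    funext x
    by_cases hx : x = 0
    · simp [hx]
    · simp [hx]
  · rw [h1, h3]
  · rw [h2, h3]

/-- `A^⊥ = I - A A^†`, the orthogonal projection onto the kernel of the symmetric matrix `A`. -/
def perp {d : ℕ} (A : Matrix (Fin d) (Fin d) ℝ) : Matrix (Fin d) (Fin d) ℝ :=
  1 - A * pinv A

/-- Frobenius norm. -/
def frobeniusNorm {d : ℕ} (A : Matrix (Fin d) (Fin d) ℝ) : ℝ :=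
  Real.sqrt (∑ i, ∑ j, A i j ^ 2)

/-- Euclidean norm of the vector `A v`. -/
def mulVecNorm {d : ℕ} (A : Matrix (Fin d) (Fin d) ℝ) (v : EuclideanSpace ℝ (Fin d)) : ℝ :=
  ‖Matrix.toEuclideanLin A v‖

/-- `R = S₀^{-1/2} (S₀^{1/2} S₁ S₀^{1/2})^{1/2} S₀^{-1/2}`. -/
def transportMatrix {d : ℕ} (S₀ S₁ : Matrix (Fin d) (Fin d) ℝ) : Matrix (Fin d) (Fin d) ℝ :=
  (sqrtm S₀)⁻¹ * sqrtm (sqrtm S₀ * S₁ * sqrtm S₀) * (sqrtm S₀)⁻¹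

/-- `Q = (R - I)^† (log(R²) R² - R² + I) (R - I)^†`. -/
def qMatrix {d : ℕ} (R : Matrix (Fin d) (Fin d) ℝ) : Matrix (Fin d) (Fin d) ℝ :=
  pinv (R - 1) * (logm (R ^ 2) * R ^ 2 - R ^ 2 + 1) * pinv (R - 1)

/-! ### Elliptic distributions -/

/-- Admissible generators `g : [0, ∞) → (0, ∞)`; values at negative arguments play no role. -/
structure IsEllipticGenerator (d : ℕ) (g : ℝ → ℝ) : Prop where
  smooth : ContDiffOn ℝ ∞ g (Set.Ici 0)
  pos : ∀ r, 0 ≤ r → 0 < g r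
  integrable : IntegrableOn g (Set.Ioi 0)
  normalization : Real.pi ^ ((d : ℝ) / 2) / Real.Gamma ((d : ℝ) / 2) *
    ∫ r in Set.Ioi (0 : ℝ), r ^ ((d : ℝ) / 2 - 1) * g r = 1
  finite_expectation : IntegrableOn (fun r : ℝ => r ^ (((d : ℝ) - 1) / 2) * g r) (Set.Ioi 0)
  finite_variance : IntegrableOn (fun r : ℝ => r ^ ((d : ℝ) / 2) * g r) (Set.Ioi 0)

/-- The density `p_{m,S,g}(x) = det(S)^{-1/2} g((x - m)ᵀ S⁻¹ (x - m))`. -/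
def ellipticDensity {d : ℕ} (m : EuclideanSpace ℝ (Fin d)) (S : Matrix (Fin d) (Fin d) ℝ)
    (g : ℝ → ℝ) (x : EuclideanSpace ℝ (Fin d)) : ℝ :=
  S.det ^ (-(1 / 2) : ℝ) * g ((x - m).ofLp ⬝ᵥ (S⁻¹ *ᵥ (x - m).ofLp))

/-- The measure with Lebesgue density `ρ`. -/
def toMeasure {d : ℕ} (ρ : EuclideanSpace ℝ (Fin d) → ℝ) : Measure (EuclideanSpace ℝ (Fin d)) :=
  volume.withDensity fun x => ENNReal.ofReal (ρ x)

/-- `μ ∼ E(m, S, g)`. -/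
structure IsElliptic {d : ℕ} (μ : Measure (EuclideanSpace ℝ (Fin d)))
    (m : EuclideanSpace ℝ (Fin d)) (S : Matrix (Fin d) (Fin d) ℝ) (g : ℝ → ℝ) : Prop where
  generator : IsEllipticGenerator d g
  posDef : S.PosDef
  eq_density : μ = toMeasure (ellipticDensity m S g)

/-- `κ_g = (1/d) ∫ ‖y‖² g(‖y‖²) dy`. -/
def kappa (d : ℕ) (g : ℝ → ℝ) : ℝ :=
  1 / (d : ℝ) * ∫ y : EuclideanSpace ℝ (Fin d), ‖y‖ ^ 2 * g (‖y‖ ^ 2)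

/-! ### Dual geodesics and the divergence of the Otto–Wasserstein geometry -/

/-- Smooth positive probability densities on `ℝ^d`. -/
def densityManifold (d : ℕ) : Set (EuclideanSpace ℝ (Fin d) → ℝ) :=
  {ρ | ContDiff ℝ ∞ ρ ∧ (∀ x, 0 < ρ x) ∧ Integrable ρ volume ∧ ∫ x, ρ x = 1}

/-- Divergence `∑ᵢ ∂ᵢ vᵢ` of a vector field on `ℝ^d`. -/
def divergence {d : ℕ} (v : EuclideanSpace ℝ (Fin d) → EuclideanSpace ℝ (Fin d))
    (x : EuclideanSpace ℝ (Fin d)) : ℝ :=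
  ∑ i, (fderiv ℝ v x (EuclideanSpace.single i 1)).ofLp i

/-- The Otto inertia operator `φ_ρ([f]) = -∇ · (ρ ∇f)`. -/
def ottoInertia {d : ℕ} (ρ f : EuclideanSpace ℝ (Fin d) → ℝ) (x : EuclideanSpace ℝ (Fin d)) : ℝ :=
  -divergence (fun y => ρ y • ∇ f y) x

/-- The squared Otto norm `∫ ‖∇f‖² ρ dx` of the tangent vector `φ_ρ([f])`. -/
def ottoNormSq {d : ℕ} (ρ f : EuclideanSpace ℝ (Fin d) → ℝ) : ℝ≥0∞ :=
  ∫⁻ x, ENNReal.ofReal (‖∇ f x‖ ^ 2) ∂(toMeasure ρ)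

/-- The curve `γ` of densities (only `t ∈ [0, 1]` matters) is the dual geodesic whose tangent
vector at every time `t` is `φ_{γ(t)}([f])`, for one and the same smooth potential `f`. -/
structure IsDualGeodesic {d : ℕ} (γ : ℝ → EuclideanSpace ℝ (Fin d) → ℝ)
    (f : EuclideanSpace ℝ (Fin d) → ℝ) : Prop where
  mem : ∀ t ∈ Set.Icc (0 : ℝ) 1, γ t ∈ densityManifold d
  smooth_potential : ContDiff ℝ ∞ f
  hasDeriv : ∀ t ∈ Set.Icc (0 : ℝ) 1, ∀ x,
    HasDerivWithinAt (fun s => γ s x) (ottoInertia (γ t) f x) (Set.Icc 0 1) t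

/-- The canonical contrast function `∫₀¹ t ‖γ'(t)‖²_{γ(t)} dt`, minimized over the dual geodesics
from `μ` to `ν` that belong to the class `C` of curves. -/
def ottoDivergence {d : ℕ} (C : Set (ℝ → EuclideanSpace ℝ (Fin d) → ℝ))
    (μ ν : Measure (EuclideanSpace ℝ (Fin d))) : ℝ≥0∞ :=
  sInf {a | ∃ γ ∈ C, ∃ f, IsDualGeodesic γ f ∧ toMeasure (γ 0) = μ ∧ toMeasure (γ 1) = ν ∧
    a = ∫⁻ t in Set.Icc (0 : ℝ) 1, ENNReal.ofReal t * ottoNormSq (γ t) f}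

/-- Smooth curves in the submanifold `{p_{m,S,g}}` of elliptic densities with generator `g`. -/
def ellipticCurves (d : ℕ) (g : ℝ → ℝ) : Set (ℝ → EuclideanSpace ℝ (Fin d) → ℝ) :=
  {γ | ∃ (m : ℝ → EuclideanSpace ℝ (Fin d)) (S : ℝ → Matrix (Fin d) (Fin d) ℝ),
    ContDiffOn ℝ ∞ m (Set.Icc 0 1) ∧ (∀ i j, ContDiffOn ℝ ∞ (fun t => S t i j) (Set.Icc 0 1)) ∧
    ∀ t ∈ Set.Icc (0 : ℝ) 1, (S t).PosDef ∧ γ t = ellipticDensity (m t) (S t) g}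

/-- The WKL divergence on the elliptic family with generator `g`. The potentials are arbitrary
smooth functions; they are not required to be quadratic. -/
def wklDivergence {d : ℕ} (g : ℝ → ℝ) (μ ν : Measure (EuclideanSpace ℝ (Fin d))) : ℝ≥0∞ :=
  ottoDivergence (ellipticCurves d g) μ ν

end WKL

end

noncomputable section

namespace WKL

/-! ### Functional calculus of symmetric matrices -/

section FunctionalCalculus

variable {d : ℕ} {A : Matrix (Fin d) (Fin d) ℝ}

/-! Up to curves of infinite energy there is only one competitor, and its energy is an explicit
integral.

Existence. If `A` is symmetric, the affine field `x ↦ A x + b` is the gradient of a quadratic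
potential. Its flow has linear part `exp(tA)`, so it carries elliptic laws to elliptic laws with the
same generator: the scatter becomes `exp(tA) S₀ exp(tA)` and the location moves by `(∫₀ᵗ exp(sA) ds)
v`, where `v = A m₀ + b` is the initial velocity of the location. Since `R S₀ R = S₁`, the choice `A
= log R` reaches `S₁` at time 1. The matrix `∫₀¹ exp(sA) ds` is invertible, so some `v` produces the
required `Δm` (`exists_dualGeodesic`).

Uniqueness. At a time of finite Otto norm, the velocity of a curve in the elliptic family is the
tangent vector of some quadratic potential, found by solving the Lyapunov equation `A S + S A = S'`
(`exists_lyapunov`, `hasDerivWithinAt_ellipticDensity`). The given potential and the quadratic one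
have the same weighted divergence, and both gradients are square integrable, so
`gradient_eq_zero_of_divergence_eq_zero` forces the gradients to agree. As the potential does not
depend on time, `A` and `b` are constant and the parameters solve linear equations
(`IsDualGeodesic.exists_affine`). The law determines its parameters (`elliptic_injective`), and `R`
is the only positive definite solution of `X S₀ X = S₁` (`eq_transportMatrix`); hence the endpoints
fix `A` and `v`.

Value. The second moments of an elliptic law make the energy `⟨v, φ(A) v⟩ + κ tr(S₀ A² φ(A))` with
`φ(a) = ∫₀¹ t exp(2ta) dt` (`lintegral_energy`). Every matrix in the closed form built from `R`
alone is a function of `A`, so the formulas reduce to scalar identities on the spectrum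
(`sq_expIntegral_mul_weight`, `qWeight_mul_sq`). The kernel of `log R` is where the pseudo-inverse
in `Q` returns zero, and the term `2 log(R)^⊥` supplies the missing value `4 φ(0) = 2`. -/

theorem continuousOn_spectrum (A : Matrix (Fin d) (Fin d) ℝ) (f : ℝ → ℝ) :
    ContinuousOn f (spectrum ℝ A) :=
  A.finite_real_spectrum.continuousOn f

/-- A real matrix has finite spectrum, so every function is continuous there. This matters because
`x ↦ x⁻¹`, with value 0 at 0, is discontinuous on the line. -/
theorem cfc_mul_cfc (f g : ℝ → ℝ) (A : Matrix (Fin d) (Fin d) ℝ) :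
    cfc f A * cfc g A = cfc (fun x => f x * g x) A :=
  (cfc_mul f g A (continuousOn_spectrum A f) (continuousOn_spectrum A g)).symm

theorem cfc_add_cfc (f g : ℝ → ℝ) (A : Matrix (Fin d) (Fin d) ℝ) :
    cfc f A + cfc g A = cfc (fun x => f x + g x) A :=
  (cfc_add A f g (continuousOn_spectrum A f) (continuousOn_spectrum A g)).symm

theorem cfc_sub_cfc (f g : ℝ → ℝ) (A : Matrix (Fin d) (Fin d) ℝ) :
    cfc f A - cfc g A = cfc (fun x => f x - g x) A :=
  (cfc_sub f g A (continuousOn_spectrum A f) (continuousOn_spectrum A g)).symm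

theorem cfc_const_one_eq (hA : A.IsHermitian) : cfc (fun _ : ℝ => (1 : ℝ)) A = 1 :=
  cfc_const_one ℝ A hA

theorem cfc_id_eq (hA : A.IsHermitian) : cfc (fun x : ℝ => x) A = A :=
  cfc_id' ℝ A hA

theorem cfc_cfc (f g : ℝ → ℝ) (hA : A.IsHermitian) :
    cfc g (cfc f A) = cfc (fun x => g (f x)) A :=
  (cfc_comp' g f A ((A.finite_real_spectrum.image f).continuousOn g)
    (continuousOn_spectrum A f) hA).symm

theorem isHermitian_cfc (f : ℝ → ℝ) (A : Matrix (Fin d) (Fin d) ℝ) : (cfc f A).IsHermitian :=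
  cfc_predicate f A

theorem transpose_cfc (f : ℝ → ℝ) (A : Matrix (Fin d) (Fin d) ℝ) : (cfc f A)ᵀ = cfc f A := by
  have h := (isHermitian_cfc f A).eq
  rwa [Matrix.conjTranspose_eq_transpose_of_trivial] at h

theorem posDef_iff_spectrum_pos :
    A.PosDef ↔ A.IsHermitian ∧ ∀ x ∈ spectrum ℝ A, 0 < x := by
  constructor
  · intro h
    refine ⟨h.1, fun x hx => ?_⟩
    rw [h.1.spectrum_real_eq_range_eigenvalues] at hx
    obtain ⟨i, rfl⟩ := hx
    exact h.eigenvalues_pos i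
  · rintro ⟨h, hx⟩
    exact h.posDef_iff_eigenvalues_pos.2 fun i => hx _ (h.eigenvalues_mem_spectrum_real i)

theorem spectrum_cfc (f : ℝ → ℝ) (hA : A.IsHermitian) :
    spectrum ℝ (cfc f A) = Set.image f (spectrum ℝ A) :=
  cfc_map_spectrum f A hA (continuousOn_spectrum A f)

theorem posSemidef_cfc (hA : A.IsHermitian) {f : ℝ → ℝ} (hf : ∀ x ∈ spectrum ℝ A, 0 ≤ f x) :
    (cfc f A).PosSemidef := by
  have h := isHermitian_cfc f A
  refine h.posSemidef_iff_eigenvalues_nonneg.2 fun i => ?_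
  have hi := h.eigenvalues_mem_spectrum_real i
  rw [spectrum_cfc f hA] at hi
  obtain ⟨x, hx, hxi⟩ := hi
  rw [← hxi]
  exact hf x hx

theorem posDef_cfc (hA : A.IsHermitian) {f : ℝ → ℝ} (hf : ∀ x ∈ spectrum ℝ A, 0 < f x) :
    (cfc f A).PosDef := by
  refine posDef_iff_spectrum_pos.2 ⟨isHermitian_cfc f A, fun y hy => ?_⟩
  rw [spectrum_cfc f hA] at hy
  obtain ⟨x, hx, rfl⟩ := hy
  exact hf x hx

/-- Spectral decomposition: every function of `A` is the same combination of fixed matrices. -/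
theorem exists_cfc_eq_sum (hA : A.IsHermitian) :
    ∃ (a : Fin d → ℝ) (P : Fin d → Matrix (Fin d) (Fin d) ℝ),
      (∀ i, a i ∈ spectrum ℝ A) ∧ ∀ f : ℝ → ℝ, cfc f A = ∑ i, f (a i) • P i := by
  refine ⟨hA.eigenvalues, fun i => Unitary.conjStarAlgAut ℝ _ hA.eigenvectorUnitary
    (Matrix.diagonal (Pi.single i 1)), hA.eigenvalues_mem_spectrum_real, fun f => ?_⟩
  rw [hA.cfc_eq, Matrix.IsHermitian.cfc]
  simp_rw [← map_smul, ← map_sum]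
  congr 1
  ext i j
  by_cases h : i = j
  · subst h
    simp [Matrix.sum_apply, Pi.single_apply]
  · simp [Matrix.sum_apply, h]

/-- Only the function varies, not the matrix; the spectral decomposition then leaves finitely many
scalar derivatives multiplied by fixed matrices. -/
theorem hasDerivAt_cfc_apply (hA : A.IsHermitian) {F F' : ℝ → ℝ → ℝ} {t : ℝ}
    (h : ∀ a ∈ spectrum ℝ A, HasDerivAt (fun s => F s a) (F' t a) t) (i j : Fin d) :
    HasDerivAt (fun s => cfc (F s) A i j) (cfc (F' t) A i j) t := by
  obtain ⟨a, P, ha, hP⟩ := exists_cfc_eq_sum hA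
  simp_rw [hP, Matrix.sum_apply, Matrix.smul_apply, smul_eq_mul]
  exact HasDerivAt.fun_sum fun k _ => (h _ (ha k)).mul_const _

theorem contDiff_cfc_apply (hA : A.IsHermitian) {F : ℝ → ℝ → ℝ}
    (h : ∀ a ∈ spectrum ℝ A, ContDiff ℝ ∞ (fun s => F s a)) (i j : Fin d) :
    ContDiff ℝ ∞ (fun s => cfc (F s) A i j) := by
  obtain ⟨a, P, ha, hP⟩ := exists_cfc_eq_sum hA
  simp_rw [hP, Matrix.sum_apply, Matrix.smul_apply, smul_eq_mul]
  exact ContDiff.sum fun k _ => (h _ (ha k)).mul contDiff_const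

theorem linearMap_cfc_intervalIntegral (hA : A.IsHermitian)
    (ℓ : Matrix (Fin d) (Fin d) ℝ →ₗ[ℝ] ℝ) {F : ℝ → ℝ → ℝ} {a b : ℝ}
    (h : ∀ x ∈ spectrum ℝ A, IntervalIntegrable (fun s => F s x) volume a b) :
    ∫ s in a..b, ℓ (cfc (F s) A) = ℓ (cfc (fun x => ∫ s in a..b, F s x) A) := by
  obtain ⟨e, P, he, hP⟩ := exists_cfc_eq_sum hA
  simp_rw [hP, map_sum, map_smul, smul_eq_mul]
  rw [intervalIntegral.integral_finsetSum fun i _ => (h _ (he i)).mul_const _]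
  simp_rw [intervalIntegral.integral_mul_const]

theorem continuous_linearMap_cfc (hA : A.IsHermitian)
    (ℓ : Matrix (Fin d) (Fin d) ℝ →ₗ[ℝ] ℝ) {F : ℝ → ℝ → ℝ}
    (h : ∀ x ∈ spectrum ℝ A, Continuous fun s => F s x) :
    Continuous fun s => ℓ (cfc (F s) A) := by
  obtain ⟨e, P, he, hP⟩ := exists_cfc_eq_sum hA
  simp_rw [hP, map_sum, map_smul, smul_eq_mul]
  exact continuous_finsetSum _ fun i _ => (h _ (he i)).mul continuous_const

theorem posDef_sqrtm (hA : A.PosDef) : (sqrtm A).PosDef :=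
  posDef_cfc hA.1 fun x hx => Real.sqrt_pos.2 ((posDef_iff_spectrum_pos.1 hA).2 x hx)

theorem sqrtm_mul_self (hA : A.PosSemidef) : sqrtm A * sqrtm A = A := by
  rw [sqrtm, cfc_mul_cfc]
  conv_rhs => rw [← cfc_id_eq hA.1]
  refine cfc_congr fun x hx => ?_
  rw [hA.1.spectrum_real_eq_range_eigenvalues] at hx
  obtain ⟨i, rfl⟩ := hx
  exact Real.mul_self_sqrt (hA.eigenvalues_nonneg i)

/-- Writing `A` as the function `x * x` of `X` makes the square root a composition, equal to the
identity on the positive spectrum of `X`. -/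
theorem sqrtm_eq_of_mul_self {X : Matrix (Fin d) (Fin d) ℝ} (hX : X.PosDef) (h : X * X = A) :
    sqrtm A = X := by
  have hA : A = cfc (fun x : ℝ => x * x) X := by
    rw [← cfc_mul_cfc, cfc_id_eq hX.1, h]
  rw [hA, sqrtm, cfc_cfc _ _ hX.1]
  conv_rhs => rw [← cfc_id_eq hX.1]
  refine cfc_congr fun x hx => ?_
  exact Real.sqrt_mul_self ((posDef_iff_spectrum_pos.1 hX).2 x hx).le

theorem det_sqrtm (hA : A.PosDef) : (sqrtm A).det = A.det ^ (1 / 2 : ℝ) := by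
  have h := congrArg Matrix.det (sqrtm_mul_self hA.posSemidef)
  rw [Matrix.det_mul] at h
  rw [← Real.sqrt_eq_rpow, ← h, Real.sqrt_mul_self (posDef_sqrtm hA).det_pos.le]

theorem transpose_eq (hA : A.IsHermitian) : Aᵀ = A := by
  have h := hA.eq
  rwa [Matrix.conjTranspose_eq_transpose_of_trivial] at h

theorem mul_inv_self (hA : A.PosDef) : A * A⁻¹ = 1 :=
  Matrix.mul_nonsing_inv _ hA.det_pos.ne'.isUnit

theorem inv_mul_self (hA : A.PosDef) : A⁻¹ * A = 1 :=
  Matrix.nonsing_inv_mul _ hA.det_pos.ne'.isUnit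

theorem posDef_mul_mul {B : Matrix (Fin d) (Fin d) ℝ} (hA : A.PosDef) (hB : B.PosDef) :
    (B * A * B).PosDef := by
  have h := hA.conjTranspose_mul_mul_same (B := B)
    (Matrix.mulVec_injective_of_isUnit hB.isUnit)
  rwa [hB.1.eq] at h

section Transport

variable {S₀ S₁ X : Matrix (Fin d) (Fin d) ℝ}

theorem posDef_transportMatrix (h₀ : S₀.PosDef) (h₁ : S₁.PosDef) :
    (transportMatrix S₀ S₁).PosDef :=
  posDef_mul_mul (posDef_sqrtm (posDef_mul_mul h₁ (posDef_sqrtm h₀))) (posDef_sqrtm h₀).inv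

theorem transportMatrix_mul_mul (h₀ : S₀.PosDef) (h₁ : S₁.PosDef) :
    transportMatrix S₀ S₁ * S₀ * transportMatrix S₀ S₁ = S₁ := by
  have hL := posDef_sqrtm h₀
  have hM := sqrtm_mul_self (posDef_mul_mul h₁ hL).posSemidef
  have h0 := sqrtm_mul_self h₀.posSemidef
  have e1 := mul_inv_self hL
  have e2 := inv_mul_self hL
  rw [transportMatrix]
  set L := sqrtm S₀
  set M := sqrtm (L * S₁ * L)
  calc L⁻¹ * M * L⁻¹ * S₀ * (L⁻¹ * M * L⁻¹)
      = L⁻¹ * M * (L⁻¹ * L) * (L * L⁻¹) * M * L⁻¹ := by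
        rw [← h0]; simp only [Matrix.mul_assoc]
    _ = L⁻¹ * (M * M) * L⁻¹ := by rw [e1, e2]; simp only [Matrix.mul_assoc, Matrix.one_mul]
    _ = (L⁻¹ * L) * S₁ * (L * L⁻¹) := by rw [hM]; simp only [Matrix.mul_assoc]
    _ = S₁ := by rw [e1, e2, Matrix.one_mul, Matrix.mul_one]

/-- With `L = √S₀`, the matrix `L X L` is a positive definite square root of `L S₁ L`, so it is the
square root, and `X` is recovered by cancelling `L`. -/
theorem eq_transportMatrix (h₀ : S₀.PosDef) (hX : X.PosDef) (h : X * S₀ * X = S₁) :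
    X = transportMatrix S₀ S₁ := by
  have hL := posDef_sqrtm h₀
  have h0 := sqrtm_mul_self h₀.posSemidef
  have e1 := mul_inv_self hL
  have e2 := inv_mul_self hL
  rw [transportMatrix]
  set L := sqrtm S₀
  have hM : sqrtm (L * S₁ * L) = L * X * L := by
    refine sqrtm_eq_of_mul_self (posDef_mul_mul hX hL) ?_
    rw [← h, ← h0]; simp only [Matrix.mul_assoc]
  rw [hM]
  calc X = (L⁻¹ * L) * X * (L * L⁻¹) := by rw [e1, e2, Matrix.one_mul, Matrix.mul_one]
    _ = L⁻¹ * (L * X * L) * L⁻¹ := by simp only [Matrix.mul_assoc]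

end Transport

end FunctionalCalculus

/-! ### Matrices acting on Euclidean space -/

section EuclideanAction

variable {d : ℕ}

theorem toEuclideanLin_mul_apply (A B : Matrix (Fin d) (Fin d) ℝ) (x : EuclideanSpace ℝ (Fin d)) :
    (A * B).toEuclideanLin x = A.toEuclideanLin (B.toEuclideanLin x) := by
  simp

theorem toEuclideanLin_one_apply (x : EuclideanSpace ℝ (Fin d)) :
    (1 : Matrix (Fin d) (Fin d) ℝ).toEuclideanLin x = x := by
  simp

theorem inner_toEuclideanLin_right (A : Matrix (Fin d) (Fin d) ℝ)
    (x y : EuclideanSpace ℝ (Fin d)) :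
    inner ℝ x (A.toEuclideanLin y) = x.ofLp ⬝ᵥ (A *ᵥ y.ofLp) := by
  rw [EuclideanSpace.inner_eq_star_dotProduct, dotProduct_comm]
  simp

theorem inner_toEuclideanLin_left (A : Matrix (Fin d) (Fin d) ℝ)
    (x y : EuclideanSpace ℝ (Fin d)) :
    inner ℝ (A.toEuclideanLin x) y = inner ℝ x (Aᵀ.toEuclideanLin y) := by
  rw [inner_toEuclideanLin_right, real_inner_comm, inner_toEuclideanLin_right,
    Matrix.dotProduct_mulVec, ← Matrix.mulVec_transpose, dotProduct_comm]

theorem det_toEuclideanLin (A : Matrix (Fin d) (Fin d) ℝ) :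
    LinearMap.det A.toEuclideanLin = A.det := by
  rw [Matrix.toEuclideanLin, Matrix.toLpLin_eq_toLin, LinearMap.det_toLin]

theorem norm_toEuclideanLin_sq (A : Matrix (Fin d) (Fin d) ℝ) (x : EuclideanSpace ℝ (Fin d)) :
    ‖A.toEuclideanLin x‖ ^ 2 = inner ℝ x ((Aᵀ * A).toEuclideanLin x) := by
  rw [← real_inner_self_eq_norm_sq, inner_toEuclideanLin_left, toEuclideanLin_mul_apply]

theorem norm_toEuclideanLin_sq_eq_sum (A : Matrix (Fin d) (Fin d) ℝ)
    (x : EuclideanSpace ℝ (Fin d)) :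
    ‖A.toEuclideanLin x‖ ^ 2 = ∑ i, inner ℝ (WithLp.toLp 2 (A.row i)) x ^ 2 := by
  rw [EuclideanSpace.norm_sq_eq]
  refine Finset.sum_congr rfl fun i _ => ?_
  rw [Real.norm_eq_abs, sq_abs, EuclideanSpace.inner_eq_star_dotProduct, dotProduct_comm]
  simp [Matrix.mulVec]
  rfl

theorem sum_norm_row_sq (A : Matrix (Fin d) (Fin d) ℝ) :
    ∑ i, ‖(WithLp.toLp 2 (A.row i) : EuclideanSpace ℝ (Fin d))‖ ^ 2 = (A * Aᵀ).trace := by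
  simp_rw [EuclideanSpace.norm_sq_eq, Matrix.trace, Matrix.diag_apply, Matrix.mul_apply,
    Matrix.row_apply, Matrix.transpose_apply, Real.norm_eq_abs, sq_abs, sq]

end EuclideanAction

/-! ### The standard elliptic law and its moments -/

section Radial

variable {d : ℕ} {g : ℝ → ℝ}

/-- Polar coordinates followed by the substitution `r = s²`. -/
theorem integrable_radial_iff (hd : 0 < d) (f : ℝ → ℝ) :
    Integrable (fun y : EuclideanSpace ℝ (Fin d) => f (‖y‖ ^ 2)) ↔
      IntegrableOn (fun r : ℝ => r ^ ((d : ℝ) / 2 - 1) * f r) (Set.Ioi 0) := by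
  have : Nonempty (Fin d) := ⟨⟨0, hd⟩⟩
  rw [integrable_fun_norm_addHaar (volume : Measure (EuclideanSpace ℝ (Fin d)))
    (f := fun s => f (s ^ 2)), ← integrableOn_Ioi_comp_rpow_iff'
      (fun r : ℝ => r ^ ((d : ℝ) / 2 - 1) * f r)
      (two_ne_zero (α := ℝ))]
  refine integrableOn_congr_fun (fun x (hx : 0 < x) => ?_) measurableSet_Ioi
  rw [finrank_euclideanSpace_fin, smul_eq_mul, smul_eq_mul, ← Real.rpow_mul hx.le, ← mul_assoc,
    ← Real.rpow_add hx, Real.rpow_two, ← Real.rpow_natCast x (d - 1), Nat.cast_pred hd]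
  congr 2
  ring

theorem integral_radial (hd : 0 < d) (f : ℝ → ℝ) :
    ∫ y : EuclideanSpace ℝ (Fin d), f (‖y‖ ^ 2) =
      Real.pi ^ ((d : ℝ) / 2) / Real.Gamma ((d : ℝ) / 2) *
        ∫ r in Set.Ioi (0 : ℝ), r ^ ((d : ℝ) / 2 - 1) * f r := by
  have : Nonempty (Fin d) := ⟨⟨0, hd⟩⟩
  have hd' : (0 : ℝ) < d := by exact_mod_cast hd
  rw [integral_fun_norm_addHaar (volume : Measure (EuclideanSpace ℝ (Fin d)))
    (fun s => f (s ^ 2)), ← integral_comp_rpow_Ioi_of_pos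
      (g := fun r : ℝ => r ^ ((d : ℝ) / 2 - 1) * f r) (zero_lt_two (α := ℝ))]
  have h : ∀ x ∈ Set.Ioi (0 : ℝ), (2 * x ^ ((2 : ℝ) - 1)) •
      ((x ^ (2 : ℝ)) ^ ((d : ℝ) / 2 - 1) * f (x ^ (2 : ℝ))) =
      2 * (x ^ (d - 1) • f (x ^ 2)) := by
    intro x (hx : 0 < x)
    rw [smul_eq_mul, smul_eq_mul, ← Real.rpow_mul hx.le, Real.rpow_two,
      ← Real.rpow_natCast x (d - 1), Nat.cast_pred hd]
    have : x ^ ((d : ℝ) - 1) = x ^ ((2 : ℝ) - 1) * x ^ (2 * ((d : ℝ) / 2 - 1)) := by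
      rw [← Real.rpow_add hx]; congr 1; ring
    rw [this]; ring
  rw [setIntegral_congr_fun measurableSet_Ioi h, integral_const_mul, finrank_euclideanSpace_fin,
    Measure.real, EuclideanSpace.volume_ball, Fintype.card_fin]
  simp only [ENNReal.ofReal_one, one_pow, one_mul]
  have hG : 0 < Real.Gamma ((d : ℝ) / 2) := Real.Gamma_pos_of_pos (by positivity)
  rw [ENNReal.toReal_ofReal (by rw [Real.Gamma_add_one (by positivity)]; positivity),
    Real.Gamma_add_one (by positivity), nsmul_eq_mul, smul_eq_mul, ← mul_assoc, ← mul_assoc]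
  congr 1
  have : √Real.pi ^ d = Real.pi ^ ((d : ℝ) / 2) := by
    rw [Real.sqrt_eq_rpow, ← Real.rpow_natCast, ← Real.rpow_mul Real.pi_pos.le]
    congr 1; ring
  rw [this]
  field_simp

/-- The standard elliptic law with generator `g`. -/
def standardLaw (d : ℕ) (g : ℝ → ℝ) : Measure (EuclideanSpace ℝ (Fin d)) :=
  toMeasure fun y => g (‖y‖ ^ 2)

theorem IsEllipticGenerator.continuous_radial (hg : IsEllipticGenerator d g) :
    Continuous fun y : EuclideanSpace ℝ (Fin d) => g (‖y‖ ^ 2) :=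
  hg.smooth.continuousOn.comp_continuous (by fun_prop)
    fun y => Set.mem_Ici.2 (sq_nonneg _)

theorem IsEllipticGenerator.integrableOn_mass (hg : IsEllipticGenerator d g) :
    IntegrableOn (fun r : ℝ => r ^ ((d : ℝ) / 2 - 1) * g r) (Set.Ioi 0) := by
  by_contra h
  have := hg.normalization
  -- A non-integrable function has integral 0 by convention, which contradicts the normalization to
  -- 1.
  rw [integral_undef h, mul_zero] at this
  exact zero_ne_one this

theorem IsEllipticGenerator.integrable_radial (hd : 0 < d) (hg : IsEllipticGenerator d g) :
    Integrable fun y : EuclideanSpace ℝ (Fin d) => g (‖y‖ ^ 2) :=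
  (integrable_radial_iff hd g).2 hg.integrableOn_mass

theorem IsEllipticGenerator.integral_radial_eq_one (hd : 0 < d) (hg : IsEllipticGenerator d g) :
    ∫ y : EuclideanSpace ℝ (Fin d), g (‖y‖ ^ 2) = 1 := by
  rw [integral_radial hd g, hg.normalization]

theorem IsEllipticGenerator.isProbabilityMeasure_standardLaw (hd : 0 < d)
    (hg : IsEllipticGenerator d g) : IsProbabilityMeasure (standardLaw d g) := by
  constructor
  rw [standardLaw, toMeasure, withDensity_apply _ MeasurableSet.univ, Measure.restrict_univ,
    ← ofReal_integral_eq_lintegral_ofReal (hg.integrable_radial hd)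
      (Filter.Eventually.of_forall fun y => (hg.pos _ (sq_nonneg _)).le),
    hg.integral_radial_eq_one hd, ENNReal.ofReal_one]

theorem IsEllipticGenerator.integrable_radial_sq (hd : 0 < d) (hg : IsEllipticGenerator d g) :
    Integrable fun y : EuclideanSpace ℝ (Fin d) => ‖y‖ ^ 2 * g (‖y‖ ^ 2) := by
  refine (integrable_radial_iff hd fun r => r * g r).2 ?_
  refine (integrableOn_congr_fun (fun x (hx : 0 < x) => ?_) measurableSet_Ioi).1 hg.finite_variance
  rw [← mul_assoc]
  congr 1
  rw [Real.rpow_sub_one hx.ne']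
  field_simp

theorem integrable_standardLaw_iff (hg : IsEllipticGenerator d g)
    {F : EuclideanSpace ℝ (Fin d) → ℝ} :
    Integrable F (standardLaw d g) ↔ Integrable (fun y => F y * g (‖y‖ ^ 2)) := by
  rw [standardLaw, toMeasure, integrable_withDensity_iff
    (hg.continuous_radial.measurable.ennreal_ofReal) (by simp)]
  simp_rw [ENNReal.toReal_ofReal (hg.pos _ (sq_nonneg _)).le]

theorem integral_standardLaw (hg : IsEllipticGenerator d g)
    (F : EuclideanSpace ℝ (Fin d) → ℝ) :
    ∫ y, F y ∂standardLaw d g = ∫ y, F y * g (‖y‖ ^ 2) := by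
  rw [standardLaw, toMeasure, integral_withDensity_eq_integral_toReal_smul
    (hg.continuous_radial.measurable.ennreal_ofReal) (by simp)]
  simp_rw [ENNReal.toReal_ofReal (hg.pos _ (sq_nonneg _)).le, smul_eq_mul, mul_comm]

theorem integrable_norm_sq_standardLaw (hd : 0 < d) (hg : IsEllipticGenerator d g) :
    Integrable (fun y => ‖y‖ ^ 2) (standardLaw d g) :=
  (integrable_standardLaw_iff hg).2 (hg.integrable_radial_sq hd)

theorem integral_norm_sq_standardLaw (hd : 0 < d) (hg : IsEllipticGenerator d g) :
    ∫ y, ‖y‖ ^ 2 ∂standardLaw d g = d * kappa d g := by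
  have : (d : ℝ) ≠ 0 := by exact_mod_cast hd.ne'
  rw [integral_standardLaw hg, kappa]
  field_simp

theorem kappa_pos (hd : 0 < d) (hg : IsEllipticGenerator d g) : 0 < kappa d g := by
  have : Nonempty (Fin d) := ⟨⟨0, hd⟩⟩
  have hd' : (0 : ℝ) < d := by exact_mod_cast hd
  have hnn : ∀ y : EuclideanSpace ℝ (Fin d), 0 ≤ ‖y‖ ^ 2 * g (‖y‖ ^ 2) := fun y =>
    mul_nonneg (sq_nonneg _) (hg.pos _ (sq_nonneg _)).le
  refine mul_pos (by positivity) ?_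
  obtain ⟨y, hy⟩ := exists_ne (0 : EuclideanSpace ℝ (Fin d))
  refine integral_pos_of_integrable_nonneg_nonzero (x := y)
    ((by fun_prop : Continuous fun y : EuclideanSpace ℝ (Fin d) => ‖y‖ ^ 2).mul
      hg.continuous_radial) (hg.integrable_radial_sq hd) hnn ?_
  exact (mul_pos (by positivity) (hg.pos _ (sq_nonneg _))).ne'

theorem measurePreserving_standardLaw (hg : IsEllipticGenerator d g)
    (U : EuclideanSpace ℝ (Fin d) ≃ₗᵢ[ℝ] EuclideanSpace ℝ (Fin d)) :
    MeasurePreserving U (standardLaw d g) (standardLaw d g) := by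
  refine ⟨U.continuous.measurable, Measure.ext fun s hs => ?_⟩
  rw [Measure.map_apply U.continuous.measurable hs, standardLaw, toMeasure,
    withDensity_apply _ hs, withDensity_apply _ (U.continuous.measurable hs),
    ← (U.measurePreserving).setLIntegral_comp_preimage hs
      hg.continuous_radial.measurable.ennreal_ofReal]
  simp

theorem integral_comp_isometry_standardLaw (hg : IsEllipticGenerator d g)
    (U : EuclideanSpace ℝ (Fin d) ≃ₗᵢ[ℝ] EuclideanSpace ℝ (Fin d))
    (F : EuclideanSpace ℝ (Fin d) → ℝ) :
    ∫ y, F (U y) ∂standardLaw d g = ∫ y, F y ∂standardLaw d g :=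
  (measurePreserving_standardLaw hg U).integral_comp U.toHomeomorph.measurableEmbedding F

theorem integrable_inner_sq_standardLaw (hd : 0 < d) (hg : IsEllipticGenerator d g)
    (u : EuclideanSpace ℝ (Fin d)) :
    Integrable (fun y => inner ℝ u y ^ 2) (standardLaw d g) := by
  refine ((integrable_norm_sq_standardLaw hd hg).const_mul (‖u‖ ^ 2)).mono'
    (by fun_prop) (Filter.Eventually.of_forall fun y => ?_)
  rw [Real.norm_eq_abs, abs_of_nonneg (sq_nonneg _), ← mul_pow, ← sq_abs]
  exact pow_le_pow_left₀ (abs_nonneg _) (abs_real_inner_le_norm u y) 2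

theorem integrable_inner_standardLaw (hd : 0 < d) (hg : IsEllipticGenerator d g)
    (u : EuclideanSpace ℝ (Fin d)) :
    Integrable (fun y => inner ℝ u y) (standardLaw d g) := by
  have := hg.isProbabilityMeasure_standardLaw hd
  refine ((integrable_inner_sq_standardLaw hd hg u).add (integrable_const (1 : ℝ))).mono'
    (by fun_prop) (Filter.Eventually.of_forall fun y => ?_)
  rw [Real.norm_eq_abs, Pi.add_apply]
  nlinarith [sq_abs (inner ℝ u y), sq_nonneg (|inner ℝ u y| - 1), abs_nonneg (inner ℝ u y)]

/-- The law is invariant under `y ↦ -y` and the integrand is odd. -/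
theorem integral_inner_standardLaw (hg : IsEllipticGenerator d g)
    (u : EuclideanSpace ℝ (Fin d)) :
    ∫ y, inner ℝ u y ∂standardLaw d g = 0 := by
  have h := integral_comp_isometry_standardLaw hg (LinearIsometryEquiv.neg ℝ)
    (fun y => inner ℝ u y)
  simp only [LinearIsometryEquiv.coe_neg, inner_neg_right, integral_neg] at h
  linarith

/-- Rotation invariance makes the integral depend on the length of `u` only; summing over an
orthonormal basis gives `E‖y‖² = d κ`, so each unit vector contributes `κ`. -/
theorem integral_inner_sq_standardLaw (hd : 0 < d) (hg : IsEllipticGenerator d g)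
    (u : EuclideanSpace ℝ (Fin d)) :
    ∫ y, inner ℝ u y ^ 2 ∂standardLaw d g = kappa d g * ‖u‖ ^ 2 := by
  have hrot : ∀ u v : EuclideanSpace ℝ (Fin d), ‖u‖ = ‖v‖ →
      ∫ y, inner ℝ u y ^ 2 ∂standardLaw d g = ∫ y, inner ℝ v y ^ 2 ∂standardLaw d g := by
    intro u v huv
    -- The reflection in the hyperplane orthogonal to `u - v` exchanges the two vectors of equal
    -- length.
    rw [← integral_comp_isometry_standardLaw hg
      ((Submodule.span ℝ {u - v})ᗮ.reflection) (fun y => inner ℝ v y ^ 2)]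
    refine integral_congr_ae (Filter.Eventually.of_forall fun y => ?_)
    have := ((Submodule.span ℝ {u - v})ᗮ.reflection).inner_map_map u y
    rw [Submodule.reflection_sub huv] at this
    simp only [this]
  let e : EuclideanSpace ℝ (Fin d) := EuclideanSpace.single ⟨0, hd⟩ 1
  have hd' : (d : ℝ) ≠ 0 := by exact_mod_cast hd.ne'
  have he : ∫ y, inner ℝ e y ^ 2 ∂standardLaw d g = kappa d g := by
    have h1 : ∫ y, ‖y‖ ^ 2 ∂standardLaw d g
        = ∑ i : Fin d, ∫ y, inner ℝ (EuclideanSpace.single i (1 : ℝ)) y ^ 2 ∂standardLaw d g := by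
      rw [← integral_finsetSum _ fun i _ => integrable_inner_sq_standardLaw hd hg _]
      refine integral_congr_ae (Filter.Eventually.of_forall fun y => ?_)
      simp [EuclideanSpace.norm_sq_eq, EuclideanSpace.inner_single_left]
    rw [integral_norm_sq_standardLaw hd hg,
      Finset.sum_congr rfl fun i _ => hrot (EuclideanSpace.single i (1 : ℝ)) e (by simp [e])] at h1
    simp only [Finset.sum_const, Finset.card_univ, Fintype.card_fin, nsmul_eq_mul] at h1
    exact (mul_left_cancel₀ hd' h1).symm
  rw [hrot u (‖u‖ • e) (by simp [e, norm_smul])]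
  simp_rw [inner_smul_left, mul_pow]
  rw [integral_const_mul, he]
  simp [mul_comm]

theorem integral_affine_norm_sq_standardLaw (hd : 0 < d) (hg : IsEllipticGenerator d g)
    (c : EuclideanSpace ℝ (Fin d)) (B : Matrix (Fin d) (Fin d) ℝ) :
    Integrable (fun y => ‖c + B.toEuclideanLin y‖ ^ 2) (standardLaw d g) ∧
    ∫ y, ‖c + B.toEuclideanLin y‖ ^ 2 ∂standardLaw d g =
      ‖c‖ ^ 2 + kappa d g * (B * Bᵀ).trace := by
  have := hg.isProbabilityMeasure_standardLaw hd
  -- The cross term is linear in `y` and integrates to zero; the rows of `B` split the quadratic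
  -- term into squares of inner products.
  have hexp : (fun y : EuclideanSpace ℝ (Fin d) => ‖c + B.toEuclideanLin y‖ ^ 2) = fun y =>
      (‖c‖ ^ 2 + 2 * inner ℝ (Bᵀ.toEuclideanLin c) y) +
        ∑ i, inner ℝ (WithLp.toLp 2 (B.row i)) y ^ 2 := by
    ext y
    rw [norm_add_sq_real, norm_toEuclideanLin_sq_eq_sum, inner_toEuclideanLin_left,
      Matrix.transpose_transpose]
  have i1 : Integrable (fun y => ‖c‖ ^ 2 + 2 * inner ℝ (Bᵀ.toEuclideanLin c) y)
      (standardLaw d g) :=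
    (integrable_const _).add ((integrable_inner_standardLaw hd hg _).const_mul 2)
  have e1 : ∫ y, (‖c‖ ^ 2 + 2 * inner ℝ (Bᵀ.toEuclideanLin c) y) ∂standardLaw d g = ‖c‖ ^ 2 := by
    rw [integral_add (integrable_const _) ((integrable_inner_standardLaw hd hg _).const_mul 2),
      integral_const_mul, integral_inner_standardLaw hg]
    simp
  have i2 : Integrable (fun y => ∑ i, inner ℝ (WithLp.toLp 2 (B.row i)) y ^ 2)
      (standardLaw d g) :=
    integrable_finsetSum _ fun i _ => integrable_inner_sq_standardLaw hd hg _
  have e2 : ∫ y, ∑ i, inner ℝ (WithLp.toLp 2 (B.row i)) y ^ 2 ∂standardLaw d g =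
      kappa d g * (B * Bᵀ).trace := by
    rw [integral_finsetSum _ fun i _ => integrable_inner_sq_standardLaw hd hg _,
      ← sum_norm_row_sq, Finset.mul_sum]
    exact Finset.sum_congr rfl fun i _ => integral_inner_sq_standardLaw hd hg _
  rw [hexp]
  exact ⟨i1.add i2, by rw [integral_add i1 i2, e1, e2]⟩

end Radial

/-! ### Elliptic laws as affine images of the standard law -/

section EllipticLaw

variable {d : ℕ} {g : ℝ → ℝ} {m : EuclideanSpace ℝ (Fin d)} {S : Matrix (Fin d) (Fin d) ℝ}

theorem quadForm_nonneg (hS : S.PosDef) (z : EuclideanSpace ℝ (Fin d)) :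
    0 ≤ z.ofLp ⬝ᵥ (S⁻¹ *ᵥ z.ofLp) := by
  simpa using hS.inv.posSemidef.dotProduct_mulVec_nonneg z.ofLp

theorem quadForm_sqrtm (hS : S.PosDef) (y : EuclideanSpace ℝ (Fin d)) :
    ((sqrtm S).toEuclideanLin y).ofLp ⬝ᵥ (S⁻¹ *ᵥ ((sqrtm S).toEuclideanLin y).ofLp) =
      ‖y‖ ^ 2 := by
  have hL := posDef_sqrtm hS
  have h : (sqrtm S)ᵀ * (S⁻¹ * sqrtm S) = 1 := by
    rw [transpose_eq hL.1]
    conv_lhs => rw [← sqrtm_mul_self hS.posSemidef, Matrix.mul_inv_rev]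
    rw [sqrtm_mul_self hS.posSemidef, Matrix.mul_assoc, inv_mul_self hL, Matrix.mul_one,
      mul_inv_self hL]
  rw [← inner_toEuclideanLin_right, inner_toEuclideanLin_left, ← toEuclideanLin_mul_apply,
    ← toEuclideanLin_mul_apply, Matrix.mul_assoc, h, toEuclideanLin_one_apply,
    real_inner_self_eq_norm_sq]

theorem contDiff_quadForm (m : EuclideanSpace ℝ (Fin d)) (S : Matrix (Fin d) (Fin d) ℝ) :
    ContDiff ℝ ∞ fun x : EuclideanSpace ℝ (Fin d) =>
      (x - m).ofLp ⬝ᵥ (S⁻¹ *ᵥ (x - m).ofLp) := by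
  simp only [dotProduct, Matrix.mulVec]
  fun_prop

theorem contDiff_ellipticDensity (hg : IsEllipticGenerator d g) (hS : S.PosDef) :
    ContDiff ℝ ∞ (ellipticDensity m S g) := by
  refine contDiff_const.mul ?_
  rw [← contDiffOn_univ]
  exact hg.smooth.comp (contDiff_quadForm m S).contDiffOn fun x _ => quadForm_nonneg hS _

theorem ellipticDensity_pos (hg : IsEllipticGenerator d g) (hS : S.PosDef)
    (x : EuclideanSpace ℝ (Fin d)) : 0 < ellipticDensity m S g x :=
  mul_pos (Real.rpow_pos_of_pos hS.det_pos _) (hg.pos _ (quadForm_nonneg hS _))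

theorem measurable_affine (m : EuclideanSpace ℝ (Fin d)) (B : Matrix (Fin d) (Fin d) ℝ) :
    Measurable fun y : EuclideanSpace ℝ (Fin d) => m + B.toEuclideanLin y :=
  (continuous_const.add (LinearMap.continuous_of_finiteDimensional _)).measurable

theorem map_affine_volume (m : EuclideanSpace ℝ (Fin d)) {B : Matrix (Fin d) (Fin d) ℝ}
    (hB : 0 < B.det) :
    (volume : Measure (EuclideanSpace ℝ (Fin d))).map (fun y => m + B.toEuclideanLin y) =
      ENNReal.ofReal (B.det)⁻¹ • volume := by
  have hL : Measurable B.toEuclideanLin :=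
    (LinearMap.continuous_of_finiteDimensional _).measurable
  have h := Measure.map_linearMap_addHaar_eq_smul_addHaar
    (volume : Measure (EuclideanSpace ℝ (Fin d))) (f := B.toEuclideanLin)
    (by rw [det_toEuclideanLin]; exact hB.ne')
  rw [det_toEuclideanLin, abs_of_pos (inv_pos.2 hB)] at h
  have hc : (fun y : EuclideanSpace ℝ (Fin d) => m + B.toEuclideanLin y) =
      (fun y => m + y) ∘ B.toEuclideanLin := rfl
  rw [hc, ← Measure.map_map (measurable_const_add m) hL, h, Measure.map_smul,
    map_add_left_eq_self]

/-- Change of variables `x = m + √S y`: the Jacobian `det √S` cancels the prefactor of the density,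
and the quadratic form becomes `‖y‖²`. -/
theorem toMeasure_ellipticDensity (hg : IsEllipticGenerator d g) (hS : S.PosDef) :
    toMeasure (ellipticDensity m S g) =
      (standardLaw d g).map fun y => m + (sqrtm S).toEuclideanLin y := by
  have hT := measurable_affine m (sqrtm S)
  have hF : Measurable fun x => ENNReal.ofReal (ellipticDensity m S g x) :=
    (contDiff_ellipticDensity hg hS).continuous.measurable.ennreal_ofReal
  have hdet : 0 < (sqrtm S).det := (posDef_sqrtm hS).det_pos
  have hval : ∀ y, ENNReal.ofReal (ellipticDensity m S g (m + (sqrtm S).toEuclideanLin y)) =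
      ENNReal.ofReal (sqrtm S).det⁻¹ * ENNReal.ofReal (g (‖y‖ ^ 2)) := by
    intro y
    rw [ellipticDensity, add_sub_cancel_left, quadForm_sqrtm hS, Real.rpow_neg hS.det_pos.le,
      ← det_sqrtm hS, ENNReal.ofReal_mul (inv_pos.2 hdet).le]
  have hvol : (volume : Measure (EuclideanSpace ℝ (Fin d))) = ENNReal.ofReal (sqrtm S).det •
      volume.map (fun y => m + (sqrtm S).toEuclideanLin y) := by
    rw [map_affine_volume m hdet, smul_smul, ← ENNReal.ofReal_mul hdet.le,
      mul_inv_cancel₀ hdet.ne', ENNReal.ofReal_one, one_smul]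
  refine Measure.ext fun s hs => ?_
  rw [Measure.map_apply hT hs, toMeasure, withDensity_apply _ hs, standardLaw, toMeasure,
    withDensity_apply _ (hT hs)]
  conv_lhs => rw [hvol]
  rw [Measure.restrict_smul, lintegral_smul_measure, setLIntegral_map hs hF hT]
  simp_rw [hval]
  rw [lintegral_const_mul _ hg.continuous_radial.measurable.ennreal_ofReal, smul_eq_mul,
    ← mul_assoc, ← ENNReal.ofReal_mul hdet.le, mul_inv_cancel₀ hdet.ne', ENNReal.ofReal_one,
    one_mul]

theorem isProbabilityMeasure_elliptic (hd : 0 < d) (hg : IsEllipticGenerator d g)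
    (hS : S.PosDef) : IsProbabilityMeasure (toMeasure (ellipticDensity m S g)) := by
  have := hg.isProbabilityMeasure_standardLaw hd
  rw [toMeasure_ellipticDensity hg hS]
  exact Measure.isProbabilityMeasure_map (measurable_affine m _).aemeasurable

theorem integrable_elliptic (hd : 0 < d) (hg : IsEllipticGenerator d g) (hS : S.PosDef) :
    Integrable (ellipticDensity m S g) := by
  have h := (isProbabilityMeasure_elliptic (m := m) hd hg hS).measure_univ
  refine ⟨(contDiff_ellipticDensity hg hS).continuous.aestronglyMeasurable, ?_⟩
  rw [hasFiniteIntegral_iff_ofReal (Filter.Eventually.of_forall fun x =>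
    (ellipticDensity_pos hg hS x).le)]
  rw [toMeasure, withDensity_apply _ MeasurableSet.univ, Measure.restrict_univ] at h
  rw [h]; exact ENNReal.one_lt_top

theorem ellipticDensity_mem_densityManifold (hd : 0 < d) (hg : IsEllipticGenerator d g)
    (hS : S.PosDef) : ellipticDensity m S g ∈ densityManifold d := by
  have hi := integrable_elliptic (m := m) hd hg hS
  have h0 : ∀ x, 0 ≤ ellipticDensity m S g x := fun x => (ellipticDensity_pos hg hS x).le
  refine ⟨contDiff_ellipticDensity hg hS, ellipticDensity_pos hg hS, hi, ?_⟩
  have h := (isProbabilityMeasure_elliptic (m := m) hd hg hS).measure_univ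
  rw [toMeasure, withDensity_apply _ MeasurableSet.univ, Measure.restrict_univ,
    ← ofReal_integral_eq_lintegral_ofReal hi (Filter.Eventually.of_forall h0)] at h
  have h1 := congrArg ENNReal.toReal h
  rwa [ENNReal.toReal_ofReal (integral_nonneg h0), ENNReal.toReal_one] at h1

/-- Second moment of an affine vector field under an elliptic law. -/
theorem lintegral_affine_norm_sq (hd : 0 < d) (hg : IsEllipticGenerator d g) (hS : S.PosDef)
    (A : Matrix (Fin d) (Fin d) ℝ) (b : EuclideanSpace ℝ (Fin d)) :
    ∫⁻ x, ENNReal.ofReal (‖A.toEuclideanLin x + b‖ ^ 2) ∂toMeasure (ellipticDensity m S g) =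
      ENNReal.ofReal (‖A.toEuclideanLin m + b‖ ^ 2 + kappa d g * (A * S * Aᵀ).trace) := by
  have hc : Continuous fun x : EuclideanSpace ℝ (Fin d) => A.toEuclideanLin x :=
    LinearMap.continuous_of_finiteDimensional _
  rw [toMeasure_ellipticDensity hg hS, lintegral_map (by fun_prop) (measurable_affine m _)]
  have h : ∀ y, A.toEuclideanLin (m + (sqrtm S).toEuclideanLin y) + b =
      (A.toEuclideanLin m + b) + (A * sqrtm S).toEuclideanLin y := by
    intro y
    rw [map_add, toEuclideanLin_mul_apply]; abel
  simp_rw [h]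
  obtain ⟨hi, he⟩ := integral_affine_norm_sq_standardLaw hd hg (A.toEuclideanLin m + b)
    (A * sqrtm S)
  rw [← ofReal_integral_eq_lintegral_ofReal hi (Filter.Eventually.of_forall fun y =>
    sq_nonneg _), he, Matrix.transpose_mul, transpose_eq (posDef_sqrtm hS).1]
  congr 4
  conv_rhs => rw [← sqrtm_mul_self hS.posSemidef]
  simp only [Matrix.mul_assoc]

theorem trace_mul_mul_transpose_nonneg (hS : S.PosDef) (A : Matrix (Fin d) (Fin d) ℝ) :
    0 ≤ (A * S * Aᵀ).trace := by
  have h := (hS.posSemidef.mul_mul_conjTranspose_same A).trace_nonneg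
  rwa [Matrix.conjTranspose_eq_transpose_of_trivial] at h

/-- An elliptic law determines its location and scatter matrix. -/
theorem elliptic_injective (hd : 0 < d) (hg : IsEllipticGenerator d g)
    {m' : EuclideanSpace ℝ (Fin d)} {S' : Matrix (Fin d) (Fin d) ℝ}
    (hS : S.PosDef) (hS' : S'.PosDef)
    (h : toMeasure (ellipticDensity m S g) = toMeasure (ellipticDensity m' S' g)) :
    m = m' ∧ S = S' := by
  have hκ := kappa_pos hd hg
  -- Equal laws have equal second moments for every affine field; suitable choices of `A` and `b`
  -- isolate the parameters.
  have key : ∀ (A : Matrix (Fin d) (Fin d) ℝ) (b : EuclideanSpace ℝ (Fin d)),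
      ‖A.toEuclideanLin m + b‖ ^ 2 + kappa d g * (A * S * Aᵀ).trace =
        ‖A.toEuclideanLin m' + b‖ ^ 2 + kappa d g * (A * S' * Aᵀ).trace := by
    intro A b
    have h1 := lintegral_affine_norm_sq (m := m) hd hg hS A b
    rw [h, lintegral_affine_norm_sq hd hg hS' A b] at h1
    have n1 := mul_nonneg hκ.le (trace_mul_mul_transpose_nonneg hS A)
    have n2 := mul_nonneg hκ.le (trace_mul_mul_transpose_nonneg hS' A)
    exact ((ENNReal.ofReal_eq_ofReal_iff (by positivity) (by positivity)).1 h1).symm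
  have hm : m = m' := by
    -- Centring at `m` and at `m'` adds `‖m - m'‖²` to opposite sides of the same trace comparison.
    have h1 := key 1 (-m)
    have h2 := key 1 (-m')
    simp only [toEuclideanLin_one_apply, add_neg_cancel, norm_zero] at h1 h2
    rw [← sub_eq_add_neg] at h1 h2
    rw [norm_sub_rev m' m] at h1
    have h3 : ‖m - m'‖ ^ 2 = 0 := by linarith
    exact sub_eq_zero.1 (norm_eq_zero.1 (pow_eq_zero_iff two_ne_zero |>.1 h3))
  refine ⟨hm, ?_⟩
  subst hm
  have htr : ∀ A : Matrix (Fin d) (Fin d) ℝ, (A * (S - S') * Aᵀ).trace = 0 := by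
    intro A
    rw [Matrix.mul_sub, Matrix.sub_mul, Matrix.trace_sub, sub_eq_zero]
    exact mul_left_cancel₀ hκ.ne' (add_left_cancel (key A 0))
  set D := S - S' with hD
  have hDt : Dᵀ = D := by rw [hD, Matrix.transpose_sub, transpose_eq hS.1, transpose_eq hS'.1]
  -- Polarization: the choices `1`, `D` and `1 + D` give `tr D = 0`, `tr D³ = 0` and `tr D + 2 tr D²
  -- + tr D³ = 0`, hence `tr D² = 0`.
  have t1 := htr 1
  have t2 := htr D
  have t3 := htr (1 + D)
  rw [hDt] at t2
  simp only [Matrix.transpose_one, Matrix.one_mul, Matrix.mul_one] at t1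
  simp only [Matrix.transpose_add, Matrix.transpose_one, hDt, Matrix.add_mul, Matrix.mul_add,
    Matrix.one_mul, Matrix.mul_one, Matrix.trace_add, t1, t2] at t3
  have t4 : (D * Dᴴ).trace = 0 := by
    rw [Matrix.conjTranspose_eq_transpose_of_trivial, hDt]; linarith
  exact sub_eq_zero.1 (Matrix.trace_mul_conjTranspose_self_eq_zero_iff.1 t4)

end EllipticLaw

/-! ### Derivatives of curves of matrices -/

section MatrixCurves

variable {d : ℕ} {S T : ℝ → Matrix (Fin d) (Fin d) ℝ} {S' T' : Matrix (Fin d) (Fin d) ℝ}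
  {s : Set ℝ} {t : ℝ}

/-- Entrywise derivative of a curve of matrices. -/
def HasMatrixDerivWithinAt (S : ℝ → Matrix (Fin d) (Fin d) ℝ) (S' : Matrix (Fin d) (Fin d) ℝ)
    (s : Set ℝ) (t : ℝ) : Prop :=
  ∀ i j, HasDerivWithinAt (fun τ => S τ i j) (S' i j) s t

theorem HasMatrixDerivWithinAt.mul (hS : HasMatrixDerivWithinAt S S' s t)
    (hT : HasMatrixDerivWithinAt T T' s t) :
    HasMatrixDerivWithinAt (fun τ => S τ * T τ) (S' * T t + S t * T') s t := by
  intro i j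
  simp only [Matrix.mul_apply, Matrix.add_apply, ← Finset.sum_add_distrib]
  exact HasDerivWithinAt.fun_sum fun k _ => (hS i k).mul (hT k j)

theorem hasMatrixDerivWithinAt_const (A : Matrix (Fin d) (Fin d) ℝ) :
    HasMatrixDerivWithinAt (fun _ => A) 0 s t :=
  fun _ _ => hasDerivWithinAt_const _ _ _

theorem HasMatrixDerivWithinAt.transpose (hS : HasMatrixDerivWithinAt S S' s t) :
    HasMatrixDerivWithinAt (fun τ => (S τ)ᵀ) S'ᵀ s t :=
  fun i j => hS j i

theorem HasMatrixDerivWithinAt.congr (hS : HasMatrixDerivWithinAt S S' s t)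
    (h : ∀ τ ∈ s, T τ = S τ) (ht : t ∈ s) : HasMatrixDerivWithinAt T S' s t :=
  fun i j => (hS i j).congr (fun τ hτ => by rw [h τ hτ]) (by rw [h t ht])

theorem HasMatrixDerivWithinAt.unique (hs : UniqueDiffWithinAt ℝ s t)
    (h₁ : HasMatrixDerivWithinAt S S' s t) (h₂ : HasMatrixDerivWithinAt S T' s t) : S' = T' := by
  ext i j
  rw [← (h₁ i j).derivWithin hs, (h₂ i j).derivWithin hs]

theorem hasDerivWithinAt_euclideanSpace_iff {m : ℝ → EuclideanSpace ℝ (Fin d)}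
    {m' : EuclideanSpace ℝ (Fin d)} :
    HasDerivWithinAt m m' s t ↔ ∀ i, HasDerivWithinAt (fun τ => (m τ).ofLp i) (m'.ofLp i) s t := by
  rw [hasDerivWithinAt_iff_hasFDerivWithinAt, hasFDerivWithinAt_euclidean]
  simp_rw [hasDerivWithinAt_iff_hasFDerivWithinAt]
  rfl

/-- Derivative of a matrix curve applied to a curve of vectors. -/
theorem HasMatrixDerivWithinAt.toEuclideanLin_apply {m : ℝ → EuclideanSpace ℝ (Fin d)}
    {m' : EuclideanSpace ℝ (Fin d)} (hS : HasMatrixDerivWithinAt S S' s t)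
    (hm : HasDerivWithinAt m m' s t) :
    HasDerivWithinAt (fun τ => (S τ).toEuclideanLin (m τ))
      (S'.toEuclideanLin (m t) + (S t).toEuclideanLin m') s t := by
  rw [hasDerivWithinAt_euclideanSpace_iff] at hm ⊢
  intro i
  simp only [PiLp.add_apply, Matrix.ofLp_toLpLin, Matrix.toLin'_apply, Matrix.mulVec, dotProduct,
    ← Finset.sum_add_distrib]
  exact HasDerivWithinAt.fun_sum fun k _ => (hS i k).mul (hm k)

/-- Jacobi's formula. -/
theorem HasMatrixDerivWithinAt.det (hS : HasMatrixDerivWithinAt S S' s t) :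
    HasDerivWithinAt (fun τ => (S τ).det) ((S t).adjugate * S').trace s t := by
  have h : HasDerivWithinAt (fun τ => (S τ).det)
      (∑ σ : Equiv.Perm (Fin d), ((Equiv.Perm.sign σ : ℤ) : ℝ) *
        ∑ i, (∏ j ∈ Finset.univ.erase i, S t (σ j) j) * S' (σ i) i) s t := by
    simp only [Matrix.det_apply']
    refine HasDerivWithinAt.fun_sum fun σ _ => HasDerivWithinAt.const_mul _ ?_
    have := HasDerivWithinAt.fun_finsetProd (u := Finset.univ) (f := fun i τ => S τ (σ i) i)
      (f' := fun i => S' (σ i) i) (x := t) (s := s) fun i _ => hS (σ i) i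
    simpa using this
  convert! h using 1
  have hdiag : ∀ i, ((S t).adjugate * S') i i = ((S t).updateCol i (fun k => S' k i)).det := by
    intro i
    rw [← Matrix.cramer_apply, Matrix.cramer_eq_adjugate_mulVec]
    rfl
  simp_rw [Matrix.trace, Matrix.diag_apply, hdiag, Matrix.det_apply', Finset.mul_sum]
  rw [Finset.sum_comm]
  refine Finset.sum_congr rfl fun σ _ => Finset.sum_congr rfl fun i _ => ?_
  congr 1
  rw [← Finset.prod_erase_mul _ _ (Finset.mem_univ i)]
  congr 1
  · refine Finset.prod_congr rfl fun j hj => ?_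
    rw [Matrix.updateCol_ne (Finset.ne_of_mem_erase hj)]
  · rw [Matrix.updateCol_self]

/-- Differentiability comes from Cramer's rule, since the entries of the adjugate are determinants;
the value then follows by differentiating `S S⁻¹ = 1`. -/
theorem HasMatrixDerivWithinAt.inv (hS : HasMatrixDerivWithinAt S S' s t)
    (hpos : ∀ τ ∈ s, (S τ).PosDef) (ht : t ∈ s) (hs : UniqueDiffWithinAt ℝ s t) :
    HasMatrixDerivWithinAt (fun τ => (S τ)⁻¹) (-((S t)⁻¹ * S' * (S t)⁻¹)) s t := by
  have hdiff : ∀ i j, DifferentiableWithinAt ℝ (fun τ => (S τ)⁻¹ i j) s t := by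
    intro i j
    have hadj : DifferentiableWithinAt ℝ (fun τ => (S τ).adjugate i j) s t := by
      simp only [Matrix.adjugate_apply]
      have hu : HasMatrixDerivWithinAt (fun τ => (S τ).updateRow j (Pi.single i 1))
          (S'.updateRow j 0) s t := by
        intro k l
        by_cases hk : k = j
        · subst hk
          simpa using hasDerivWithinAt_const t s _
        · simpa [Matrix.updateRow_ne hk] using hS k l
      exact hu.det.differentiableWithinAt
    simp only [Matrix.inv_def, Matrix.smul_apply, smul_eq_mul, Ring.inverse_eq_inv']
    exact (hS.det.differentiableWithinAt.inv (hpos t ht).det_pos.ne').mul hadj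
  obtain ⟨M', hM'⟩ : ∃ M', HasMatrixDerivWithinAt (fun τ => (S τ)⁻¹) M' s t :=
    ⟨Matrix.of fun i j => derivWithin (fun τ => (S τ)⁻¹ i j) s t,
      fun i j => (hdiff i j).hasDerivWithinAt⟩
  have h1 := (hS.mul hM').congr (T := fun _ => 1) (fun τ hτ => (mul_inv_self (hpos τ hτ)).symm) ht
  have h2 := HasMatrixDerivWithinAt.unique hs h1 (hasMatrixDerivWithinAt_const 1)
  have h3 : M' = -((S t)⁻¹ * S' * (S t)⁻¹) := by
    have h4 := congrArg (fun X => (S t)⁻¹ * X) h2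
    simp only [Matrix.mul_add, Matrix.mul_zero, ← Matrix.mul_assoc] at h4
    rw [inv_mul_self (hpos t ht), Matrix.one_mul] at h4
    exact eq_neg_of_add_eq_zero_right h4
  rwa [h3] at hM'

end MatrixCurves

/-! ### Quadratic potentials -/

section Quadratic

variable {d : ℕ} {A : Matrix (Fin d) (Fin d) ℝ} {b : EuclideanSpace ℝ (Fin d)}

/-- The potential whose gradient is the affine field `x ↦ A x + b`. -/
def quadPotential (A : Matrix (Fin d) (Fin d) ℝ) (b x : EuclideanSpace ℝ (Fin d)) : ℝ :=
  1 / 2 * inner ℝ x (A.toEuclideanLin x) + inner ℝ b x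

theorem contDiff_toEuclideanLin (A : Matrix (Fin d) (Fin d) ℝ) :
    ContDiff ℝ ∞ fun x : EuclideanSpace ℝ (Fin d) => A.toEuclideanLin x :=
  (LinearMap.toContinuousLinearMap A.toEuclideanLin).contDiff

theorem contDiff_quadPotential (A : Matrix (Fin d) (Fin d) ℝ) (b : EuclideanSpace ℝ (Fin d)) :
    ContDiff ℝ ∞ (quadPotential A b) := by
  have := contDiff_toEuclideanLin A
  exact (contDiff_const.mul (contDiff_id.inner ℝ this)).add (contDiff_const.inner ℝ contDiff_id)

theorem gradient_quadPotential (hA : Aᵀ = A) (b x : EuclideanSpace ℝ (Fin d)) :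
    ∇ (quadPotential A b) x = A.toEuclideanLin x + b := by
  have hL : HasFDerivAt (fun x : EuclideanSpace ℝ (Fin d) => A.toEuclideanLin x)
      (LinearMap.toContinuousLinearMap A.toEuclideanLin) x :=
    (LinearMap.toContinuousLinearMap A.toEuclideanLin).hasFDerivAt
  have h := (((hasFDerivAt_id x).inner ℝ hL).const_mul (1 / 2)).add
    ((hasFDerivAt_const b x).inner ℝ (hasFDerivAt_id x))
  refine HasGradientAt.gradient ?_
  rw [hasGradientAt_iff_hasFDerivAt]
  refine h.congr_fderiv ?_
  ext u
  simp only [add_apply, smul_apply,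
    ContinuousLinearMap.comp_apply, ContinuousLinearMap.prod_apply, fderivInnerCLM_apply,
    zero_apply, inner_zero_left, smul_eq_mul, id,
    InnerProductSpace.toDual_apply_apply, inner_add_left, LinearMap.coe_toContinuousLinearMap']
  have e : inner ℝ x (A.toEuclideanLin u) = inner ℝ (A.toEuclideanLin x) u := by
    rw [inner_toEuclideanLin_left, hA]
  have e' : inner ℝ u (A.toEuclideanLin x) = inner ℝ (A.toEuclideanLin x) u :=
    real_inner_comm _ _
  simp [e, e']
  ring

theorem divergence_smul {ρ : EuclideanSpace ℝ (Fin d) → ℝ}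
    {v : EuclideanSpace ℝ (Fin d) → EuclideanSpace ℝ (Fin d)} {x : EuclideanSpace ℝ (Fin d)}
    (hρ : DifferentiableAt ℝ ρ x) (hv : DifferentiableAt ℝ v x) :
    divergence (fun y => ρ y • v y) x = fderiv ℝ ρ x (v x) + ρ x * divergence v x := by
  have hx : v x = ∑ i, (v x).ofLp i • EuclideanSpace.single i (1 : ℝ) := by
    ext j
    simp [Finset.sum_apply, Pi.single_apply]
  conv_rhs => rw [hx]
  simp only [divergence, fderiv_fun_smul hρ hv, map_sum, map_smul, Finset.mul_sum,
    ← Finset.sum_add_distrib]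
  refine Finset.sum_congr rfl fun i _ => ?_
  simp
  ring

theorem divergence_affine (A : Matrix (Fin d) (Fin d) ℝ) (b x : EuclideanSpace ℝ (Fin d)) :
    divergence (fun y => A.toEuclideanLin y + b) x = A.trace := by
  have hL : HasFDerivAt (fun x : EuclideanSpace ℝ (Fin d) => A.toEuclideanLin x + b)
      (LinearMap.toContinuousLinearMap A.toEuclideanLin) x :=
    (LinearMap.toContinuousLinearMap A.toEuclideanLin).hasFDerivAt.add_const b
  simp [divergence, hL.fderiv, Matrix.trace]

theorem ottoInertia_quadPotential (hA : Aᵀ = A) {ρ : EuclideanSpace ℝ (Fin d) → ℝ}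
    {x : EuclideanSpace ℝ (Fin d)} (hρ : DifferentiableAt ℝ ρ x) :
    ottoInertia ρ (quadPotential A b) x =
      -(fderiv ℝ ρ x (A.toEuclideanLin x + b) + ρ x * A.trace) := by
  have hv : Differentiable ℝ fun y : EuclideanSpace ℝ (Fin d) => A.toEuclideanLin y + b :=
    ((contDiff_toEuclideanLin A).differentiable (by simp)).add_const b
  rw [ottoInertia]
  simp_rw [gradient_quadPotential hA]
  rw [divergence_smul hρ hv.differentiableAt, divergence_affine]

end Quadratic

/-! ### Velocity of a curve of elliptic densities -/

section Velocity

variable {d : ℕ} {g : ℝ → ℝ}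

/-- The generator is smooth only on `[0, ∞)`, so its derivative at 0 is one-sided; nonnegativity of
the inner function keeps the chain rule valid. -/
theorem hasDerivWithinAt_generator_comp (hg : IsEllipticGenerator d g) {q : ℝ → ℝ} {q' : ℝ}
    {s : Set ℝ} {t : ℝ} (hq : HasDerivWithinAt q q' s t) (h0 : ∀ τ ∈ s, 0 ≤ q τ) (ht : t ∈ s) :
    HasDerivWithinAt (fun τ => g (q τ)) (derivWithin g (Set.Ici 0) (q t) * q') s t :=
  HasDerivWithinAt.comp t
    ((hg.smooth.differentiableOn (by simp) _ (h0 t ht)).hasDerivWithinAt) hq h0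

theorem fderiv_ellipticDensity (hg : IsEllipticGenerator d g) {S : Matrix (Fin d) (Fin d) ℝ}
    (hS : S.PosDef) (m x u : EuclideanSpace ℝ (Fin d)) :
    fderiv ℝ (ellipticDensity m S g) x u = S.det ^ (-(1 / 2) : ℝ) *
      (derivWithin g (Set.Ici 0) ((x - m).ofLp ⬝ᵥ (S⁻¹ *ᵥ (x - m).ofLp)) *
        (2 * inner ℝ u (S⁻¹.toEuclideanLin (x - m)))) := by
  have hline : HasDerivAt (fun τ : ℝ => x + τ • u - m) u 0 := by
    simpa using (((hasDerivAt_id (0 : ℝ)).smul_const u).const_add x).sub_const m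
  have hq : HasDerivWithinAt (fun τ : ℝ => (x + τ • u - m).ofLp ⬝ᵥ (S⁻¹ *ᵥ (x + τ • u - m).ofLp))
      (2 * inner ℝ u (S⁻¹.toEuclideanLin (x - m))) Set.univ 0 := by
    simp_rw [← inner_toEuclideanLin_right]
    have h1 := (hasMatrixDerivWithinAt_const (s := Set.univ) (t := 0) S⁻¹).toEuclideanLin_apply
      hline.hasDerivWithinAt
    have h2 := hline.hasDerivWithinAt.inner ℝ h1
    refine h2.congr_deriv ?_
    have e : inner ℝ (x - m) (S⁻¹.toEuclideanLin u) = inner ℝ u (S⁻¹.toEuclideanLin (x - m)) := by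
      rw [real_inner_comm, inner_toEuclideanLin_left, transpose_eq hS.inv.1]
    simp only [zero_smul, add_zero, map_zero, LinearMap.zero_apply, zero_add, e]
    ring
  have h := (hasDerivWithinAt_generator_comp hg hq (fun τ _ => quadForm_nonneg hS _)
    (Set.mem_univ _)).const_mul (S.det ^ (-(1 / 2) : ℝ))
  rw [hasDerivWithinAt_univ] at h
  have hρ := ((contDiff_ellipticDensity (m := m) hg hS).differentiable (by simp)
    x).hasFDerivAt
  have hl : HasDerivAt (fun τ : ℝ => x + τ • u) u 0 := by
    simpa using ((hasDerivAt_id (0 : ℝ)).smul_const u).const_add x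
  have hρ' : HasFDerivAt (ellipticDensity m S g) (fderiv ℝ (ellipticDensity m S g) x)
      (x + (0 : ℝ) • u) := by simpa using hρ
  have h' := hρ'.comp_hasDerivAt (0 : ℝ) hl
  have := h'.unique h
  simpa using this

/-- The continuity equation for the affine field. By Jacobi's formula the determinant factor
contributes `-ρ tr A`, the divergence term. The equation `S' = A S + S A` gives `(S⁻¹)' = -(S⁻¹ A +
A S⁻¹)`, so the time derivative of the quadratic form is minus its derivative along `A x + b`. -/
theorem hasDerivWithinAt_ellipticDensity (hg : IsEllipticGenerator d g)
    {m : ℝ → EuclideanSpace ℝ (Fin d)} {S : ℝ → Matrix (Fin d) (Fin d) ℝ}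
    {A : Matrix (Fin d) (Fin d) ℝ} {b : EuclideanSpace ℝ (Fin d)} {s : Set ℝ} {t : ℝ}
    (ht : t ∈ s) (hs : UniqueDiffWithinAt ℝ s t) (hpos : ∀ τ ∈ s, (S τ).PosDef) (hA : Aᵀ = A)
    (hm : HasDerivWithinAt m (A.toEuclideanLin (m t) + b) s t)
    (hS : HasMatrixDerivWithinAt S (A * S t + S t * A) s t) (x : EuclideanSpace ℝ (Fin d)) :
    HasDerivWithinAt (fun τ => ellipticDensity (m τ) (S τ) g x)
      (ottoInertia (ellipticDensity (m t) (S t) g) (quadPotential A b) x) s t := by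
  have hSt := hpos t ht
  have e1 := mul_inv_self hSt
  have e2 := inv_mul_self hSt
  have hdet : HasDerivWithinAt (fun τ => (S τ).det) ((S t).det * (2 * A.trace)) s t := by
    refine hS.det.congr_deriv ?_
    rw [Matrix.mul_add, Matrix.trace_add, ← Matrix.mul_assoc, Matrix.trace_mul_cycle,
      ← Matrix.mul_assoc, Matrix.mul_adjugate, Matrix.adjugate_mul]
    simp only [Matrix.smul_mul, Matrix.one_mul, Matrix.trace_smul, smul_eq_mul]
    ring
  have hdet2 : HasDerivWithinAt (fun τ => (S τ).det ^ (-(1 / 2) : ℝ))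
      (-((S t).det ^ (-(1 / 2) : ℝ) * A.trace)) s t := by
    refine (hdet.rpow_const (Or.inl hSt.det_pos.ne')).congr_deriv ?_
    rw [Real.rpow_sub_one hSt.det_pos.ne']
    have := hSt.det_pos.ne'
    field_simp
  have hz : HasDerivWithinAt (fun τ => x - m τ) (-(A.toEuclideanLin (m t) + b)) s t :=
    hm.const_sub x
  have hq : HasDerivWithinAt (fun τ => (x - m τ).ofLp ⬝ᵥ ((S τ)⁻¹ *ᵥ (x - m τ).ofLp))
      (-(2 * inner ℝ (A.toEuclideanLin x + b) ((S t)⁻¹.toEuclideanLin (x - m t)))) s t := by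
    simp_rw [← inner_toEuclideanLin_right]
    refine (hz.inner ℝ ((hS.inv hpos ht hs).toEuclideanLin_apply hz)).congr_deriv ?_
    have hM : (S t)⁻¹ * (A * S t + S t * A) * (S t)⁻¹ = (S t)⁻¹ * A + A * (S t)⁻¹ := by
      rw [Matrix.mul_add, Matrix.add_mul, ← Matrix.mul_assoc, ← Matrix.mul_assoc, e2,
        Matrix.one_mul, Matrix.mul_assoc _ (S t), e1, Matrix.mul_one]
    set z := x - m t with hzdef
    set M := (S t)⁻¹ with hMdef
    have hMt : Mᵀ = M := transpose_eq hSt.inv.1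
    have i1 : inner ℝ z (M.toEuclideanLin (A.toEuclideanLin (m t) + b)) =
        inner ℝ (A.toEuclideanLin (m t) + b) (M.toEuclideanLin z) := by
      rw [real_inner_comm, inner_toEuclideanLin_left, hMt]
    have i2 : inner ℝ z ((M * A).toEuclideanLin z) =
        inner ℝ (A.toEuclideanLin z) (M.toEuclideanLin z) := by
      rw [toEuclideanLin_mul_apply, real_inner_comm, inner_toEuclideanLin_left, hMt]
    have i3 : inner ℝ z ((A * M).toEuclideanLin z) =
        inner ℝ (A.toEuclideanLin z) (M.toEuclideanLin z) := by
      rw [toEuclideanLin_mul_apply, inner_toEuclideanLin_left, hA]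
    have hx : A.toEuclideanLin x + b = A.toEuclideanLin z + (A.toEuclideanLin (m t) + b) := by
      rw [hzdef, map_sub]; abel
    rw [hx, hM]
    simp only [map_neg, map_add, LinearMap.neg_apply, LinearMap.add_apply, inner_add_right,
      inner_neg_right, inner_neg_left, inner_add_left] at i1 i2 i3 ⊢
    linarith
  have h := hdet2.mul (hasDerivWithinAt_generator_comp hg hq
    (fun τ hτ => quadForm_nonneg (hpos τ hτ) _) ht)
  refine h.congr_deriv ?_
  rw [ottoInertia_quadPotential hA
    ((contDiff_ellipticDensity hg hSt).differentiable (by simp) x),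
    fderiv_ellipticDensity hg hSt, ellipticDensity]
  ring

end Velocity

/-! ### Uniqueness of gradient fields with prescribed weighted divergence -/

section Uniqueness

variable {d : ℕ}

theorem inner_gradient_left {f : EuclideanSpace ℝ (Fin d) → ℝ} {x : EuclideanSpace ℝ (Fin d)}
    (u : EuclideanSpace ℝ (Fin d)) : inner ℝ (∇ f x) u = fderiv ℝ f x u := by
  rw [gradient, InnerProductSpace.toDual_symm_apply]

theorem contDiff_gradient {f : EuclideanSpace ℝ (Fin d) → ℝ} (hf : ContDiff ℝ ∞ f) :
    ContDiff ℝ ∞ (fun x => ∇ f x) := by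
  have h : ContDiff ℝ ∞ (fderiv ℝ f) := hf.fderiv_right (by simp)
  exact (InnerProductSpace.toDual ℝ (EuclideanSpace ℝ (Fin d))).symm.contDiff.comp h

/-- Integration by parts against a compactly supported function. -/
theorem integral_fderiv_eq_neg_integral_mul_divergence {φ : EuclideanSpace ℝ (Fin d) → ℝ}
    {v : EuclideanSpace ℝ (Fin d) → EuclideanSpace ℝ (Fin d)} (hφ : ContDiff ℝ ∞ φ)
    (hc : HasCompactSupport φ) (hv : ContDiff ℝ ∞ v) :
    ∫ x, fderiv ℝ φ x (v x) = -∫ x, φ x * divergence v x := by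
  have hdφ : Continuous (fderiv ℝ φ) := hφ.continuous_fderiv (by simp)
  have hvi : ∀ i, ContDiff ℝ ∞ fun x => (v x).ofLp i := fun i => contDiff_euclidean.1 hv i
  have hdv : ∀ i, Continuous (fderiv ℝ fun x => (v x).ofLp i) := fun i =>
    (hvi i).continuous_fderiv (by simp)
  have hfd : ∀ i x, fderiv ℝ (fun y => (v y).ofLp i) x (EuclideanSpace.single i 1) =
      (fderiv ℝ v x (EuclideanSpace.single i 1)).ofLp i := by
    intro i x
    have h := ((EuclideanSpace.proj i : EuclideanSpace ℝ (Fin d) →L[ℝ] ℝ).hasFDerivAt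
      (x := v x)).comp x (hv.differentiable (by simp) x).hasFDerivAt
    have h' : HasFDerivAt (fun y => (v y).ofLp i)
      ((EuclideanSpace.proj i : EuclideanSpace ℝ (Fin d) →L[ℝ] ℝ).comp (fderiv ℝ v x)) x := h
    rw [h'.fderiv]
    simp
  have hi1 : ∀ i, Integrable fun x => φ x * fderiv ℝ (fun y => (v y).ofLp i) x
      (EuclideanSpace.single i 1) := fun i =>
    (hφ.continuous.mul ((hdv i).clm_apply continuous_const)).integrable_of_hasCompactSupport
      hc.mul_right
  have hi2 : ∀ i, Integrable fun x => fderiv ℝ φ x (EuclideanSpace.single i 1) *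
      (v x).ofLp i := fun i =>
    ((hdφ.clm_apply continuous_const).mul (hvi i).continuous).integrable_of_hasCompactSupport
      (hc.fderiv_apply (𝕜 := ℝ) _).mul_right
  have hi3 : ∀ i, Integrable fun x => φ x * (v x).ofLp i := fun i =>
    (hφ.continuous.mul (hvi i).continuous).integrable_of_hasCompactSupport hc.mul_right
  have hx : ∀ x, fderiv ℝ φ x (v x) =
      ∑ i, fderiv ℝ φ x (EuclideanSpace.single i 1) * (v x).ofLp i := by
    intro x
    have : v x = ∑ i, (v x).ofLp i • EuclideanSpace.single i (1 : ℝ) := by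
      ext j
      simp [Finset.sum_apply, Pi.single_apply]
    conv_lhs => rw [this]
    simp [map_sum, mul_comm]
  simp_rw [hx, divergence, Finset.mul_sum, ← hfd]
  rw [integral_finsetSum _ fun i _ => hi2 i, integral_finsetSum _ fun i _ => hi1 i,
    ← Finset.sum_neg_distrib]
  refine Finset.sum_congr rfl fun i _ => ?_
  rw [integral_mul_fderiv_eq_neg_fderiv_mul_of_integrable (hi2 i) (hi1 i) (hi3 i)
    (fun x _ => hφ.differentiable (by simp) x) (fun x _ => (hvi i).differentiable (by simp) x),
    neg_neg]

/-- Smooth cutoffs on growing balls with gradients tending to zero uniformly. -/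
theorem exists_cutoff (d : ℕ) : ∃ C : ℝ, 0 ≤ C ∧ ∀ n : ℝ, 0 < n →
    ∃ χ : EuclideanSpace ℝ (Fin d) → ℝ, ContDiff ℝ ∞ χ ∧ HasCompactSupport χ ∧
      (∀ x, 0 ≤ χ x) ∧ (∀ x, ‖x‖ ≤ n → χ x = 1) ∧ ∀ x, ‖fderiv ℝ χ x‖ ≤ C / n := by
  let f : ContDiffBump (0 : EuclideanSpace ℝ (Fin d)) := ⟨1, 2, one_pos, one_lt_two⟩
  have hf : ContDiff ℝ ∞ f := f.contDiff
  obtain ⟨C, hC⟩ := (hf.continuous_fderiv (by simp)).bounded_above_of_compact_support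
    (f.hasCompactSupport.fderiv (𝕜 := ℝ))
  refine ⟨C, (norm_nonneg _).trans (hC 0), fun n hn => ⟨fun x => f (n⁻¹ • x), ?_, ?_, ?_, ?_, ?_⟩⟩
  · exact hf.comp (contDiff_const_smul _)
  · exact f.hasCompactSupport.comp_smul (inv_ne_zero hn.ne')
  · exact fun x => f.nonneg
  · intro x hx
    refine f.one_of_mem_closedBall ?_
    rw [mem_closedBall_zero_iff, norm_smul, norm_inv, Real.norm_eq_abs, abs_of_pos hn]
    change n⁻¹ * ‖x‖ ≤ 1
    rw [inv_mul_le_iff₀ hn]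
    simpa using hx
  · intro x
    rw [fderiv_comp_smul, norm_smul, norm_inv, Real.norm_eq_abs, abs_of_pos hn, div_eq_inv_mul]
    exact mul_le_mul_of_nonneg_left (hC _) (inv_nonneg.2 hn.le)

/-- A gradient field that is integrable against a positive weight is determined by its weighted
divergence. -/
theorem gradient_eq_zero_of_divergence_eq_zero {ρ h : EuclideanSpace ℝ (Fin d) → ℝ}
    (hρ : ContDiff ℝ ∞ ρ) (hpos : ∀ x, 0 < ρ x) (hh : ContDiff ℝ ∞ h)
    (hdiv : ∀ x, divergence (fun y => ρ y • ∇ h y) x = 0)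
    (hgrad : Integrable fun x => ρ x * ‖∇ h x‖) (x₀ : EuclideanSpace ℝ (Fin d)) :
    ∇ h x₀ = 0 := by
  have hgr := contDiff_gradient hh
  let v : EuclideanSpace ℝ (Fin d) → EuclideanSpace ℝ (Fin d) := fun y => ρ y • ∇ h y
  have hv : ContDiff ℝ ∞ v := hρ.smul hgr
  -- The weight produced by testing the equation against `χ arctan h`. Since `arctan` is bounded,
  -- integrability of `ρ ‖∇h‖` controls the cutoff error without any growth bound on `h`.
  let w : EuclideanSpace ℝ (Fin d) → ℝ := fun x => ρ x * ‖∇ h x‖ ^ 2 / (1 + h x ^ 2)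
  have hw : Continuous w := (hρ.continuous.mul (hgr.continuous.norm.pow 2)).div
    (continuous_const.add (hh.continuous.pow 2)) fun x => by positivity
  have hw0 : ∀ x, 0 ≤ w x := fun x => by have := hpos x; positivity
  obtain ⟨C, hC0, hC⟩ := exists_cutoff d
  set K := Real.pi / 2 * C * ∫ x, ρ x * ‖∇ h x‖ with hK
  have key : ∀ n : ℝ, 0 < n → ∃ χ : EuclideanSpace ℝ (Fin d) → ℝ, Continuous χ ∧
      HasCompactSupport χ ∧ (∀ x, 0 ≤ χ x) ∧ (∀ x, ‖x‖ ≤ n → χ x = 1) ∧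
      ∫ x, χ x * w x ≤ K / n := by
    intro n hn
    obtain ⟨χ, hχ, hχc, hχ0, hχ1, hχd⟩ := hC n hn
    refine ⟨χ, hχ.continuous, hχc, hχ0, hχ1, ?_⟩
    have hφ : ContDiff ℝ ∞ fun x => χ x * Real.arctan (h x) := hχ.mul hh.arctan
    have hibp := integral_fderiv_eq_neg_integral_mul_divergence hφ hχc.mul_right hv
    simp only [v, hdiv, mul_zero, integral_zero, neg_zero] at hibp
    have hfd : ∀ x, fderiv ℝ (fun x => χ x * Real.arctan (h x)) x (ρ x • ∇ h x) =
        χ x * w x + Real.arctan (h x) * fderiv ℝ χ x (ρ x • ∇ h x) := by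
      intro x
      have h1 := (hχ.differentiable (by simp) x).hasFDerivAt
      have h2 := (hh.differentiable (by simp) x).hasFDerivAt.arctan
      rw [(h1.fun_mul h2).fderiv]
      have h3 : fderiv ℝ h x (∇ h x) = ‖∇ h x‖ ^ 2 := by
        rw [← inner_gradient_left, real_inner_self_eq_norm_sq]
      simp only [add_apply, smul_apply, map_smul, h3, smul_eq_mul, w]
      ring
    simp_rw [hfd] at hibp
    have hdχ : Continuous (fderiv ℝ χ) := hχ.continuous_fderiv (by simp)
    have hi1 : Integrable fun x => χ x * w x :=
      (hχ.continuous.mul hw).integrable_of_hasCompactSupport hχc.mul_right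
    have hi2 : Integrable fun x => Real.arctan (h x) * fderiv ℝ χ x (ρ x • ∇ h x) := by
      refine ((Real.continuous_arctan.comp hh.continuous).mul
        (hdχ.clm_apply hv.continuous)).integrable_of_hasCompactSupport ?_
      refine HasCompactSupport.mul_left ?_
      refine (hχc.fderiv (𝕜 := ℝ)).mono fun x hx => ?_
      rw [Function.mem_support] at hx ⊢
      intro h0
      exact hx (by simp [h0])
    rw [integral_add hi1 hi2] at hibp
    have hbound : ‖∫ x, Real.arctan (h x) * fderiv ℝ χ x (ρ x • ∇ h x)‖ ≤ K / n := by
      have : K / n = ∫ x, Real.pi / 2 * (C / n) * (ρ x * ‖∇ h x‖) := by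
        rw [integral_const_mul, hK]; ring
      rw [this]
      refine norm_integral_le_of_norm_le (hgrad.const_mul _) (Filter.Eventually.of_forall
        fun x => ?_)
      rw [norm_mul, mul_assoc]
      refine mul_le_mul ?_ ?_ (norm_nonneg _) (by positivity)
      · rw [Real.norm_eq_abs, abs_le]
        exact ⟨(Real.neg_pi_div_two_lt_arctan _).le, (Real.arctan_lt_pi_div_two _).le⟩
      · refine ((fderiv ℝ χ x).le_opNorm _).trans ?_
        rw [norm_smul, Real.norm_eq_abs, abs_of_pos (hpos x)]
        exact mul_le_mul_of_nonneg_right (hχd x) (mul_nonneg (hpos x).le (norm_nonneg _))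
    have := (abs_le.1 hbound).1
    linarith
  by_contra hne
  let η : ContDiffBump x₀ := ⟨1, 2, one_pos, one_lt_two⟩
  have hηi : Integrable fun x => η x * w x :=
    (η.continuous.mul hw).integrable_of_hasCompactSupport η.hasCompactSupport.mul_right
  have hpos' : 0 < ∫ x, η x * w x := by
    refine integral_pos_of_integrable_nonneg_nonzero (x := x₀) (η.continuous.mul hw) hηi
      (fun x => mul_nonneg η.nonneg (hw0 x)) ?_
    have h1 : η x₀ = 1 := η.one_of_mem_closedBall (Metric.mem_closedBall_self zero_le_one)
    have := hpos x₀
    have := norm_pos_iff.2 hne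
    simp only [h1, one_mul, w]
    positivity
  set I := ∫ x, η x * w x
  -- The first bound puts the support of the bump inside the region where `χ = 1`; the second makes
  -- the cutoff error `K / n` smaller than `I`, a contradiction.
  obtain ⟨n, hn1, hn2⟩ : ∃ n : ℝ, ‖x₀‖ + 2 ≤ n ∧ K / I < n :=
    ⟨max (‖x₀‖ + 2) (K / I + 1), le_max_left _ _, lt_max_of_lt_right (lt_add_one _)⟩
  have hn : 0 < n := by linarith [norm_nonneg x₀]
  obtain ⟨χ, hχ, hχc, hχ0, hχ1, hχw⟩ := key n hn
  have hle : I ≤ ∫ x, χ x * w x := by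
    refine integral_mono hηi ((hχ.mul hw).integrable_of_hasCompactSupport hχc.mul_right)
      fun x => mul_le_mul_of_nonneg_right ?_ (hw0 x)
    by_cases hx : dist x x₀ < 2
    · rw [hχ1 x]
      · exact η.le_one
      · rw [dist_eq_norm] at hx
        have := norm_sub_norm_le x x₀
        linarith
    · rw [η.zero_of_le_dist (not_lt.1 hx)]
      exact hχ0 x
  have h1 : I ≤ K / n := hle.trans hχw
  rw [le_div_iff₀ hn] at h1
  rw [div_lt_iff₀ hpos'] at hn2
  linarith [mul_comm I n]

end Uniqueness

/-! ### Rigidity of dual geodesics of finite energy -/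

section Rigidity

variable {d : ℕ} {g : ℝ → ℝ}

/-- Solvability of the Lyapunov equation. -/
theorem exists_lyapunov {S B : Matrix (Fin d) (Fin d) ℝ} (hS : S.PosDef) (hB : Bᵀ = B) :
    ∃ A : Matrix (Fin d) (Fin d) ℝ, Aᵀ = A ∧ A * S + S * A = B := by
  let L : Matrix (Fin d) (Fin d) ℝ →ₗ[ℝ] Matrix (Fin d) (Fin d) ℝ :=
    LinearMap.mulRight ℝ S + LinearMap.mulLeft ℝ S
  have hL : ∀ A, L A = A * S + S * A := fun A => rfl
  -- Injectivity suffices in finite dimension. Pairing `A S + S A = 0` with `A` gives two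
  -- nonnegative traces of sum zero, so `A √S = 0`.
  have hinj : Function.Injective L := by
    rw [← LinearMap.ker_eq_bot, LinearMap.ker_eq_bot']
    intro A hA
    rw [hL] at hA
    have h1 := trace_mul_mul_transpose_nonneg hS A
    have h2 := trace_mul_mul_transpose_nonneg hS Aᵀ
    have h3 := congrArg (fun X => (X * Aᵀ).trace) hA
    simp only [Matrix.add_mul, Matrix.trace_add, Matrix.zero_mul, Matrix.trace_zero] at h3
    rw [Matrix.transpose_transpose] at h2
    have h4 : (S * A * Aᵀ).trace = (Aᵀ * S * A).trace := by
      rw [Matrix.trace_mul_comm, Matrix.mul_assoc]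
    have h5 : (A * S * Aᵀ).trace = 0 := by linarith
    have hL := sqrtm_mul_self hS.posSemidef
    have hLt := transpose_eq (posDef_sqrtm hS).1
    have h6 : (A * sqrtm S) * (A * sqrtm S)ᴴ = A * S * Aᵀ := by
      rw [Matrix.conjTranspose_eq_transpose_of_trivial, Matrix.transpose_mul, hLt]
      conv_rhs => rw [← hL]
      simp only [Matrix.mul_assoc]
    rw [← h6, Matrix.trace_mul_conjTranspose_self_eq_zero_iff] at h5
    calc A = A * sqrtm S * (sqrtm S)⁻¹ := by
          rw [Matrix.mul_assoc, mul_inv_self (posDef_sqrtm hS), Matrix.mul_one]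
      _ = 0 := by rw [h5, Matrix.zero_mul]
  obtain ⟨A, hA⟩ := (LinearMap.injective_iff_surjective.1 hinj) B
  -- The transpose of a solution solves the same equation, so injectivity makes the solution
  -- symmetric.
  refine ⟨A, hinj ?_, hA⟩
  rw [hA, ← hB, ← hA, hL, hL, Matrix.transpose_add, Matrix.transpose_mul, Matrix.transpose_mul,
    transpose_eq hS.1, add_comm]

theorem integrable_toMeasure_iff {ρ F : EuclideanSpace ℝ (Fin d) → ℝ} (hρ : Continuous ρ)
    (h0 : ∀ x, 0 ≤ ρ x) :
    Integrable F (toMeasure ρ) ↔ Integrable fun x => F x * ρ x := by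
  rw [toMeasure, integrable_withDensity_iff hρ.measurable.ennreal_ofReal (by simp)]
  simp_rw [ENNReal.toReal_ofReal (h0 _)]

theorem ottoNormSq_elliptic_affine (hd : 0 < d) (hg : IsEllipticGenerator d g)
    {S : Matrix (Fin d) (Fin d) ℝ} (hS : S.PosDef) {m : EuclideanSpace ℝ (Fin d)}
    {f : EuclideanSpace ℝ (Fin d) → ℝ} {A : Matrix (Fin d) (Fin d) ℝ}
    {b : EuclideanSpace ℝ (Fin d)} (hf : ∀ x, ∇ f x = A.toEuclideanLin x + b) :
    ottoNormSq (ellipticDensity m S g) f =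
      ENNReal.ofReal (‖A.toEuclideanLin m + b‖ ^ 2 + kappa d g * (A * S * Aᵀ).trace) := by
  simp_rw [ottoNormSq, hf]
  exact lintegral_affine_norm_sq hd hg hS A b

/-- The tangent vector of a quadratic potential has no other potential of finite energy. -/
theorem gradient_eq_affine (hd : 0 < d) (hg : IsEllipticGenerator d g)
    {S : Matrix (Fin d) (Fin d) ℝ} (hS : S.PosDef) {m : EuclideanSpace ℝ (Fin d)}
    {f : EuclideanSpace ℝ (Fin d) → ℝ} (hf : ContDiff ℝ ∞ f) {A : Matrix (Fin d) (Fin d) ℝ}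
    (hA : Aᵀ = A) {b : EuclideanSpace ℝ (Fin d)}
    (heq : ∀ x, ottoInertia (ellipticDensity m S g) f x =
      ottoInertia (ellipticDensity m S g) (quadPotential A b) x)
    (hfin : ottoNormSq (ellipticDensity m S g) f ≠ ⊤) (x : EuclideanSpace ℝ (Fin d)) :
    ∇ f x = A.toEuclideanLin x + b := by
  set ρ := ellipticDensity m S g
  have hρ : ContDiff ℝ ∞ ρ := contDiff_ellipticDensity hg hS
  have hpos : ∀ x, 0 < ρ x := ellipticDensity_pos hg hS
  have hρi : Integrable ρ := integrable_elliptic hd hg hS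
  have hq := contDiff_quadPotential A b
  have hgr : ∀ y, ∇ (fun z => f z - quadPotential A b z) y = ∇ f y - ∇ (quadPotential A b) y := by
    intro y
    rw [gradient, gradient, gradient, fderiv_fun_sub (hf.differentiable (by simp) y)
      (hq.differentiable (by simp) y), map_sub]
  have hsm : ∀ p : EuclideanSpace ℝ (Fin d) → ℝ, ContDiff ℝ ∞ p →
      Differentiable ℝ fun y => ρ y • ∇ p y := fun p hp =>
    (hρ.smul (contDiff_gradient hp)).differentiable (by simp)
  have hfinint : ∀ p : EuclideanSpace ℝ (Fin d) → ℝ, ContDiff ℝ ∞ p → ottoNormSq ρ p ≠ ⊤ →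
      Integrable fun y => ‖∇ p y‖ ^ 2 * ρ y := by
    intro p hp hfp
    rw [← integrable_toMeasure_iff hρ.continuous fun y => (hpos y).le]
    refine ⟨((contDiff_gradient hp).continuous.norm.pow 2).aestronglyMeasurable, ?_⟩
    rw [hasFiniteIntegral_iff_ofReal (Filter.Eventually.of_forall fun y => sq_nonneg _)]
    exact lt_top_iff_ne_top.2 hfp
  have hI1 := hfinint f hf hfin
  have hI2 := hfinint (quadPotential A b) hq (by
    rw [ottoNormSq_elliptic_affine hd hg hS (gradient_quadPotential hA b)]
    exact ENNReal.ofReal_ne_top)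
  have hzero := gradient_eq_zero_of_divergence_eq_zero hρ hpos (hf.sub hq) (fun y => by
    have h1 := heq y
    simp only [ottoInertia, neg_inj] at h1
    simp_rw [hgr, smul_sub]
    simp only [divergence] at h1 ⊢
    rw [fderiv_fun_sub (hsm f hf y) (hsm _ hq y)]
    simp only [sub_apply, PiLp.sub_apply, Finset.sum_sub_distrib]
    exact sub_eq_zero.2 h1) (by
    have hc : Continuous fun y => ∇ (fun z => f z - quadPotential A b z) y :=
      (contDiff_gradient (hf.sub hq)).continuous
    -- Finite energy and finite mass give first moments through `s ≤ 1 + s²`.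
    refine ((hρi.add hI1).add (hρi.add hI2)).mono' (hρ.continuous.mul hc.norm).aestronglyMeasurable
      (Filter.Eventually.of_forall fun y => ?_)
    have h1 : ‖∇ f y - ∇ (quadPotential A b) y‖ ≤ (1 + ‖∇ f y‖ ^ 2) +
        (1 + ‖∇ (quadPotential A b) y‖ ^ 2) := by
      have := norm_sub_le (∇ f y) (∇ (quadPotential A b) y)
      nlinarith [sq_nonneg (‖∇ f y‖ - 1), sq_nonneg (‖∇ (quadPotential A b) y‖ - 1),
        norm_nonneg (∇ f y), norm_nonneg (∇ (quadPotential A b) y)]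
    rw [hgr, Real.norm_eq_abs, abs_of_nonneg (mul_nonneg (hpos y).le (norm_nonneg _))]
    simp only [Pi.add_apply]
    nlinarith [mul_le_mul_of_nonneg_left h1 (hpos y).le]) x
  rw [hgr, sub_eq_zero, gradient_quadPotential hA] at hzero
  exact hzero

/-- The weight `t` has positive integral, so infinite norm at all times would make the energy
infinite. One good time is enough to start the rigidity argument. -/
theorem exists_ottoNormSq_ne_top {γ : ℝ → EuclideanSpace ℝ (Fin d) → ℝ}
    {f : EuclideanSpace ℝ (Fin d) → ℝ}
    (h : ∫⁻ t in Set.Icc (0 : ℝ) 1, ENNReal.ofReal t * ottoNormSq (γ t) f ≠ ⊤) :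
    ∃ t ∈ Set.Icc (0 : ℝ) 1, ottoNormSq (γ t) f ≠ ⊤ := by
  by_contra! hcon
  refine h ?_
  have : ∫⁻ t in Set.Icc (0 : ℝ) 1, ENNReal.ofReal t * ottoNormSq (γ t) f =
      ∫⁻ t in Set.Icc (0 : ℝ) 1, ENNReal.ofReal t * ⊤ :=
    setLIntegral_congr_fun measurableSet_Icc fun t ht => by rw [hcon t ht]
  rw [this, lintegral_mul_const _ ENNReal.measurable_ofReal]
  refine ENNReal.mul_top ?_
  have hne : 0 < ∫⁻ t in Set.Icc (0 : ℝ) 1, ENNReal.ofReal t := by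
    rw [setLIntegral_pos_iff ENNReal.measurable_ofReal]
    refine lt_of_lt_of_le ?_ (measure_mono (μ := volume) (s := Set.Ioc (0 : ℝ) 1) ?_)
    · simp
    · intro t ht
      exact ⟨by simpa using ht.1, ht.1.le, ht.2⟩
  exact hne.ne'

theorem velocity_of_ottoNormSq_ne_top (hd : 0 < d) (hg : IsEllipticGenerator d g)
    {γ : ℝ → EuclideanSpace ℝ (Fin d) → ℝ} {f : EuclideanSpace ℝ (Fin d) → ℝ}
    (hγ : IsDualGeodesic γ f) {m : ℝ → EuclideanSpace ℝ (Fin d)}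
    {S : ℝ → Matrix (Fin d) (Fin d) ℝ} (hm : ContDiffOn ℝ ∞ m (Set.Icc 0 1))
    (hS : ∀ i j, ContDiffOn ℝ ∞ (fun t => S t i j) (Set.Icc 0 1))
    (hmem : ∀ t ∈ Set.Icc (0 : ℝ) 1, (S t).PosDef ∧ γ t = ellipticDensity (m t) (S t) g)
    {t : ℝ} (ht : t ∈ Set.Icc (0 : ℝ) 1) (hfin : ottoNormSq (γ t) f ≠ ⊤) :
    ∃ (A : Matrix (Fin d) (Fin d) ℝ) (b : EuclideanSpace ℝ (Fin d)), Aᵀ = A ∧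
      (∀ x, ∇ f x = A.toEuclideanLin x + b) ∧
      HasMatrixDerivWithinAt S (A * S t + S t * A) (Set.Icc 0 1) t ∧
      HasDerivWithinAt m (A.toEuclideanLin (m t) + b) (Set.Icc 0 1) t := by
  have hs : UniqueDiffWithinAt ℝ (Set.Icc (0 : ℝ) 1) t := uniqueDiffOn_Icc zero_lt_one t ht
  have hSt := (hmem t ht).1
  let B : Matrix (Fin d) (Fin d) ℝ :=
    Matrix.of fun i j => derivWithin (fun τ => S τ i j) (Set.Icc 0 1) t
  have hB : HasMatrixDerivWithinAt S B (Set.Icc 0 1) t := fun i j =>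
    ((hS i j).differentiableOn (by simp) t ht).hasDerivWithinAt
  have hBt : Bᵀ = B := HasMatrixDerivWithinAt.unique hs
    (hB.transpose.congr (fun τ hτ => (transpose_eq (hmem τ hτ).1.1).symm) ht) hB
  -- The derivative of the scatter is symmetric, so it has Lyapunov form; `b` is then chosen to
  -- match the velocity of the location.
  obtain ⟨A, hA, hAB⟩ := exists_lyapunov hSt hBt
  let m' := derivWithin m (Set.Icc 0 1) t
  have hm' : HasDerivWithinAt m m' (Set.Icc 0 1) t :=
    (hm.differentiableOn (by simp) t ht).hasDerivWithinAt
  have hb : A.toEuclideanLin (m t) + (m' - A.toEuclideanLin (m t)) = m' := by abel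
  rw [← hAB] at hB
  rw [← hb] at hm'
  refine ⟨A, m' - A.toEuclideanLin (m t), hA, ?_, hB, hm'⟩
  rw [(hmem t ht).2] at hfin
  refine gradient_eq_affine hd hg hSt hγ.smooth_potential hA (fun x => ?_) hfin
  have h1 := hγ.hasDeriv t ht x
  rw [(hmem t ht).2] at h1
  have h2 := hasDerivWithinAt_ellipticDensity hg ht hs (fun τ hτ => (hmem τ hτ).1) hA hm' hB x
  have h3 := h2.congr (fun τ hτ => congrFun (hmem τ hτ).2 x) (congrFun (hmem t ht).2 x)
  rw [← h1.derivWithin hs, h3.derivWithin hs]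

/-- The potential of a dual geodesic of finite energy is quadratic. -/
theorem IsDualGeodesic.exists_affine (hd : 0 < d) (hg : IsEllipticGenerator d g)
    {γ : ℝ → EuclideanSpace ℝ (Fin d) → ℝ} {f : EuclideanSpace ℝ (Fin d) → ℝ}
    (hγ : IsDualGeodesic γ f) {m : ℝ → EuclideanSpace ℝ (Fin d)}
    {S : ℝ → Matrix (Fin d) (Fin d) ℝ} (hm : ContDiffOn ℝ ∞ m (Set.Icc 0 1))
    (hS : ∀ i j, ContDiffOn ℝ ∞ (fun t => S t i j) (Set.Icc 0 1))
    (hmem : ∀ t ∈ Set.Icc (0 : ℝ) 1, (S t).PosDef ∧ γ t = ellipticDensity (m t) (S t) g)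
    (hfin : ∫⁻ t in Set.Icc (0 : ℝ) 1, ENNReal.ofReal t * ottoNormSq (γ t) f ≠ ⊤) :
    ∃ (A : Matrix (Fin d) (Fin d) ℝ) (b : EuclideanSpace ℝ (Fin d)), Aᵀ = A ∧
      (∀ x, ∇ f x = A.toEuclideanLin x + b) ∧ ∀ t ∈ Set.Icc (0 : ℝ) 1,
      HasMatrixDerivWithinAt S (A * S t + S t * A) (Set.Icc 0 1) t ∧
      HasDerivWithinAt m (A.toEuclideanLin (m t) + b) (Set.Icc 0 1) t := by
  obtain ⟨t₀, ht₀, hfin₀⟩ := exists_ottoNormSq_ne_top hfin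
  obtain ⟨A, b, hA, hf, -, -⟩ := velocity_of_ottoNormSq_ne_top hd hg hγ hm hS hmem ht₀ hfin₀
  refine ⟨A, b, hA, hf, fun t ht => ?_⟩
  -- Once the gradient is known to be affine, finite variance makes the energy finite at every time,
  -- and the local result applies everywhere with the same `A` and `b`.
  have hfin_t : ottoNormSq (γ t) f ≠ ⊤ := by
    rw [(hmem t ht).2, ottoNormSq_elliptic_affine hd hg (hmem t ht).1 hf]
    exact ENNReal.ofReal_ne_top
  obtain ⟨A', b', hA', hf', hS', hm'⟩ :=
    velocity_of_ottoNormSq_ne_top hd hg hγ hm hS hmem ht hfin_t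
  have hb : b = b' := by
    have h := (hf 0).symm.trans (hf' 0)
    simpa using h
  subst hb
  have hAA : A = A' := by
    refine Matrix.toEuclideanLin.injective (LinearMap.ext fun x => ?_)
    exact add_right_cancel ((hf x).symm.trans (hf' x))
  subst hAA
  exact ⟨hS', hm'⟩

end Rigidity

/-! ### The linear flow generated by a symmetric matrix -/

section Flow

variable {d : ℕ} {A : Matrix (Fin d) (Fin d) ℝ}

/-- The exponential `exp(tA)`. -/
def flow (A : Matrix (Fin d) (Fin d) ℝ) (t : ℝ) : Matrix (Fin d) (Fin d) ℝ :=
  cfc (fun a : ℝ => Real.exp (t * a)) A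

/-- The integral `∫₀ᵗ exp(sa) ds`. -/
def expIntegral (t a : ℝ) : ℝ :=
  if a = 0 then t else (Real.exp (t * a) - 1) / a

/-- The integral `∫₀ᵗ exp(sA) ds`. -/
def flowIntegral (A : Matrix (Fin d) (Fin d) ℝ) (t : ℝ) : Matrix (Fin d) (Fin d) ℝ :=
  cfc (expIntegral t) A

theorem hasDerivAt_expIntegral (a t : ℝ) :
    HasDerivAt (fun s => expIntegral s a) (Real.exp (t * a)) t := by
  by_cases ha : a = 0
  · simpa [expIntegral, ha] using hasDerivAt_id' t
  · simp only [expIntegral, ha, if_false]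
    have h : HasDerivAt (fun s => Real.exp (s * a)) (Real.exp (t * a) * (1 * a)) t :=
      ((hasDerivAt_id t).mul_const a).exp
    refine ((h.sub_const 1).div_const a).congr_deriv ?_
    field_simp

theorem contDiff_expIntegral (a : ℝ) : ContDiff ℝ ∞ fun s => expIntegral s a := by
  by_cases ha : a = 0
  · simpa [expIntegral, ha] using contDiff_fun_id
  · simp only [expIntegral, ha, if_false]
    fun_prop

theorem mul_expIntegral (t a : ℝ) : a * expIntegral t a = Real.exp (t * a) - 1 := by
  by_cases ha : a = 0
  · simp [expIntegral, ha]
  · simp only [expIntegral, ha, if_false]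
    field_simp

/-- This makes `∫₀¹ exp(sA) ds` invertible, so displacement and initial velocity determine each
other. -/
theorem expIntegral_one_ne_zero (a : ℝ) : expIntegral 1 a ≠ 0 := by
  by_cases ha : a = 0
  · simp [expIntegral, ha]
  · simp only [expIntegral, ha, if_false, one_mul]
    exact div_ne_zero (sub_ne_zero.2 fun h => ha (Real.exp_eq_one_iff a |>.1 h)) ha

theorem flow_zero (hA : A.IsHermitian) : flow A 0 = 1 := by
  simpa [flow] using cfc_const_one_eq hA

theorem flow_mul_flow (A : Matrix (Fin d) (Fin d) ℝ) (s t : ℝ) :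
    flow A s * flow A t = flow A (s + t) := by
  simp_rw [flow, cfc_mul_cfc, add_mul, Real.exp_add]

theorem transpose_flow (A : Matrix (Fin d) (Fin d) ℝ) (t : ℝ) : (flow A t)ᵀ = flow A t :=
  transpose_cfc _ _

theorem posDef_flow (hA : A.IsHermitian) (t : ℝ) : (flow A t).PosDef :=
  posDef_cfc hA fun _ _ => Real.exp_pos _

theorem mul_flow (hA : A.IsHermitian) (t : ℝ) :
    A * flow A t = cfc (fun a => a * Real.exp (t * a)) A := by
  conv_lhs => rw [← cfc_id_eq hA]
  rw [flow, cfc_cfc _ _ hA, cfc_mul_cfc]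

theorem flow_mul (hA : A.IsHermitian) (t : ℝ) : flow A t * A = A * flow A t := by
  rw [mul_flow hA]
  conv_lhs => rw [← cfc_id_eq hA]
  rw [flow, cfc_cfc _ _ hA, cfc_mul_cfc]
  simp_rw [mul_comm]

theorem flowIntegral_zero (A : Matrix (Fin d) (Fin d) ℝ) : flowIntegral A 0 = 0 := by
  have h : expIntegral 0 = fun _ => 0 := by
    funext a
    simp [expIntegral]
  rw [flowIntegral, h]
  simp

theorem mul_flowIntegral (hA : A.IsHermitian) (t : ℝ) :
    A * flowIntegral A t = flow A t - 1 := by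
  conv_lhs => rw [← cfc_id_eq hA]
  rw [flowIntegral, cfc_cfc _ _ hA, cfc_mul_cfc, ← cfc_const_one_eq hA, flow, cfc_sub_cfc]
  simp_rw [mul_expIntegral]

theorem hasMatrixDerivWithinAt_flow (hA : A.IsHermitian) (s : Set ℝ) (t : ℝ) :
    HasMatrixDerivWithinAt (flow A) (A * flow A t) s t := by
  intro i j
  rw [mul_flow hA]
  refine (hasDerivAt_cfc_apply (F' := fun t a => a * Real.exp (t * a)) hA
    (fun a _ => ?_) i j).hasDerivWithinAt
  refine ((hasDerivAt_id t).mul_const a).exp.congr_deriv ?_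
  simp [mul_comm]

theorem hasMatrixDerivWithinAt_flow_neg (hA : A.IsHermitian) (s : Set ℝ) (t : ℝ) :
    HasMatrixDerivWithinAt (fun τ => flow A (-τ)) (-(A * flow A (-t))) s t := by
  intro i j
  have h := (hasMatrixDerivWithinAt_flow hA Set.univ (-t)) i j
  rw [hasDerivWithinAt_univ] at h
  have h2 := h.scomp t (hasDerivAt_neg t)
  refine h2.hasDerivWithinAt.congr_deriv ?_
  simp

theorem hasMatrixDerivWithinAt_flowIntegral (hA : A.IsHermitian) (s : Set ℝ) (t : ℝ) :
    HasMatrixDerivWithinAt (flowIntegral A) (flow A t) s t := fun i j =>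
  (hasDerivAt_cfc_apply (F' := fun t a => Real.exp (t * a)) hA
    (fun a _ => hasDerivAt_expIntegral a t) i j).hasDerivWithinAt

theorem contDiff_flow_apply (hA : A.IsHermitian) (i j : Fin d) :
    ContDiff ℝ ∞ fun t => flow A t i j :=
  contDiff_cfc_apply hA (fun a _ => by fun_prop) i j

theorem contDiff_flowIntegral_apply (hA : A.IsHermitian) (i j : Fin d) :
    ContDiff ℝ ∞ fun t => flowIntegral A t i j :=
  contDiff_cfc_apply hA (fun a _ => contDiff_expIntegral a) i j

theorem eq_of_hasDerivWithinAt_zero {E : Type*} [NormedAddCommGroup E] [NormedSpace ℝ E]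
    {F : ℝ → E} (h : ∀ t ∈ Set.Icc (0 : ℝ) 1, HasDerivWithinAt F 0 (Set.Icc 0 1) t)
    {t : ℝ} (ht : t ∈ Set.Icc (0 : ℝ) 1) : F t = F 0 :=
  constant_of_derivWithin_zero (fun τ hτ => (h τ hτ).differentiableWithinAt)
    (fun τ hτ => (h τ ⟨hτ.1, hτ.2.le⟩).derivWithin
      (uniqueDiffOn_Icc zero_lt_one τ ⟨hτ.1, hτ.2.le⟩)) t ht

/-- Conjugating back by `exp(-tA)` gives a curve with zero derivative. -/
theorem eq_flow_mul_mul_flow (hA : A.IsHermitian) {S : ℝ → Matrix (Fin d) (Fin d) ℝ}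
    (hS : ∀ t ∈ Set.Icc (0 : ℝ) 1,
      HasMatrixDerivWithinAt S (A * S t + S t * A) (Set.Icc 0 1) t)
    {t : ℝ} (ht : t ∈ Set.Icc (0 : ℝ) 1) : S t = flow A t * S 0 * flow A t := by
  have hconst : flow A (-t) * S t * flow A (-t) = S 0 := by
    have h0 : flow A (-0) * S 0 * flow A (-0) = S 0 := by
      rw [neg_zero, flow_zero hA, Matrix.one_mul, Matrix.mul_one]
    rw [← h0]
    ext i j
    refine eq_of_hasDerivWithinAt_zero (F := fun τ => (flow A (-τ) * S τ * flow A (-τ)) i j)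
      (fun τ hτ => ?_) ht
    have hf := hasMatrixDerivWithinAt_flow_neg hA (Set.Icc 0 1) τ
    refine (((hf.mul (hS τ hτ)).mul hf) i j).congr_deriv ?_
    have hc := flow_mul hA (-τ)
    have : (-(A * flow A (-τ)) * S τ + flow A (-τ) * (A * S τ + S τ * A)) * flow A (-τ) +
        flow A (-τ) * S τ * -(A * flow A (-τ)) = 0 := by
      simp only [Matrix.mul_add, Matrix.add_mul, Matrix.neg_mul, Matrix.mul_neg,
        ← Matrix.mul_assoc, hc]
      abel
    rw [this]; rfl
  calc S t = (flow A t * flow A (-t)) * S t * (flow A (-t) * flow A t) := by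
        rw [flow_mul_flow, flow_mul_flow, add_neg_cancel, neg_add_cancel, flow_zero hA,
          Matrix.one_mul, Matrix.mul_one]
    _ = flow A t * (flow A (-t) * S t * flow A (-t)) * flow A t := by
        simp only [Matrix.mul_assoc]
    _ = flow A t * S 0 * flow A t := by rw [hconst]

/-- The velocity `u = A m + b` satisfies the homogeneous equation `u' = A u`; hence `exp(-tA) u` is
constant. -/
theorem affine_eq_flow (hA : A.IsHermitian) {m : ℝ → EuclideanSpace ℝ (Fin d)}
    {b : EuclideanSpace ℝ (Fin d)}
    (hm : ∀ t ∈ Set.Icc (0 : ℝ) 1,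
      HasDerivWithinAt m (A.toEuclideanLin (m t) + b) (Set.Icc 0 1) t)
    {t : ℝ} (ht : t ∈ Set.Icc (0 : ℝ) 1) :
    A.toEuclideanLin (m t) + b = (flow A t).toEuclideanLin (A.toEuclideanLin (m 0) + b) := by
  have hconst : (flow A (-t)).toEuclideanLin (A.toEuclideanLin (m t) + b) =
      A.toEuclideanLin (m 0) + b := by
    have h0 : (flow A (-0)).toEuclideanLin (A.toEuclideanLin (m 0) + b) =
        A.toEuclideanLin (m 0) + b := by
      rw [neg_zero, flow_zero hA, toEuclideanLin_one_apply]
    rw [← h0]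
    refine eq_of_hasDerivWithinAt_zero
      (F := fun τ => (flow A (-τ)).toEuclideanLin (A.toEuclideanLin (m τ) + b))
      (fun τ hτ => ?_) ht
    have h1 := ((hasMatrixDerivWithinAt_const A).toEuclideanLin_apply (hm τ hτ)).add_const b
    refine ((hasMatrixDerivWithinAt_flow_neg hA _ τ).toEuclideanLin_apply h1).congr_deriv ?_
    rw [map_zero, LinearMap.zero_apply, zero_add, ← toEuclideanLin_mul_apply, flow_mul hA,
      map_neg, LinearMap.neg_apply, neg_add_cancel]
  rw [← hconst, ← toEuclideanLin_mul_apply, flow_mul_flow, add_neg_cancel, flow_zero hA,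
    toEuclideanLin_one_apply]

theorem eq_add_flowIntegral (hA : A.IsHermitian) {m : ℝ → EuclideanSpace ℝ (Fin d)}
    {b : EuclideanSpace ℝ (Fin d)}
    (hm : ∀ t ∈ Set.Icc (0 : ℝ) 1,
      HasDerivWithinAt m (A.toEuclideanLin (m t) + b) (Set.Icc 0 1) t)
    {t : ℝ} (ht : t ∈ Set.Icc (0 : ℝ) 1) :
    m t = m 0 + (flowIntegral A t).toEuclideanLin (A.toEuclideanLin (m 0) + b) := by
  set v := A.toEuclideanLin (m 0) + b with hv
  have h := eq_of_hasDerivWithinAt_zero (F := fun τ => m τ - (flowIntegral A τ).toEuclideanLin v)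
    (fun τ hτ => ?_) ht
  · simp only [flowIntegral_zero A, map_zero, LinearMap.zero_apply, sub_zero] at h
    exact sub_eq_iff_eq_add.1 h
  · refine ((hm τ hτ).sub ((hasMatrixDerivWithinAt_flowIntegral hA _ τ).toEuclideanLin_apply
      (hasDerivWithinAt_const τ _ v))).congr_deriv ?_
    rw [map_zero, add_zero, affine_eq_flow hA hm hτ, sub_self]

end Flow

/-! ### Energy of the flow -/

section Energy

variable {d : ℕ} {g : ℝ → ℝ} {A : Matrix (Fin d) (Fin d) ℝ}

/-- The integral `∫₀¹ t exp(2 t a) dt`. -/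
def expMoment (a : ℝ) : ℝ := ∫ t in (0 : ℝ)..1, t * Real.exp (2 * t * a)

/-- The factor `a²` clears the denominators of the antiderivative, so the identity also covers `a =
0`. -/
theorem sq_mul_expMoment (a : ℝ) :
    a ^ 2 * expMoment a = (2 * a * Real.exp (2 * a) - Real.exp (2 * a) + 1) / 4 := by
  have h : ∀ t ∈ Set.uIcc (0 : ℝ) 1, HasDerivAt
      (fun t => (2 * a * t * Real.exp (2 * t * a) - Real.exp (2 * t * a)) / 4)
      (a ^ 2 * (t * Real.exp (2 * t * a))) t := by
    intro t _
    have h1 : HasDerivAt (fun t : ℝ => 2 * t * a) (2 * 1 * a) t :=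
      ((hasDerivAt_id t).const_mul 2).mul_const a
    have h2 : HasDerivAt (fun t : ℝ => 2 * a * t) (2 * a * 1) t :=
      (hasDerivAt_id t).const_mul (2 * a)
    refine (((h2.mul h1.exp).sub h1.exp).div_const 4).congr_deriv ?_
    ring
  rw [expMoment, ← intervalIntegral.integral_const_mul,
    intervalIntegral.integral_eq_sub_of_hasDerivAt h
      (Continuous.intervalIntegrable (by fun_prop) _ _)]
  simp
  ring

theorem expMoment_zero : expMoment 0 = 1 / 2 := by
  simp [expMoment]

/-- At each time the energy is a sum of two linear functionals of functions of `A`, because the two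
factors `exp(tA)` merge into `exp(2tA)`, in the trace by cyclicity. The time integral therefore
passes inside the functional calculus. -/
theorem lintegral_energy (hd : 0 < d) (hg : IsEllipticGenerator d g) (hA : A.IsHermitian)
    {γ : ℝ → EuclideanSpace ℝ (Fin d) → ℝ} {f : EuclideanSpace ℝ (Fin d) → ℝ}
    {m : ℝ → EuclideanSpace ℝ (Fin d)} {S : ℝ → Matrix (Fin d) (Fin d) ℝ}
    {b v : EuclideanSpace ℝ (Fin d)} {S₀ : Matrix (Fin d) (Fin d) ℝ}
    (hmem : ∀ t ∈ Set.Icc (0 : ℝ) 1, (S t).PosDef ∧ γ t = ellipticDensity (m t) (S t) g)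
    (hf : ∀ x, ∇ f x = A.toEuclideanLin x + b)
    (hS : ∀ t ∈ Set.Icc (0 : ℝ) 1, S t = flow A t * S₀ * flow A t)
    (hm : ∀ t ∈ Set.Icc (0 : ℝ) 1,
      A.toEuclideanLin (m t) + b = (flow A t).toEuclideanLin v) :
    ∫⁻ t in Set.Icc (0 : ℝ) 1, ENNReal.ofReal t * ottoNormSq (γ t) f =
      ENNReal.ofReal (inner ℝ v ((cfc expMoment A).toEuclideanLin v) +
        kappa d g * (S₀ * cfc (fun a => a ^ 2 * expMoment a) A).trace) := by
  let ℓ₁ : Matrix (Fin d) (Fin d) ℝ →ₗ[ℝ] ℝ :=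
    (innerₗ (EuclideanSpace ℝ (Fin d)) v) ∘ₗ (LinearMap.applyₗ v) ∘ₗ
      Matrix.toEuclideanLin.toLinearMap
  let ℓ₂ : Matrix (Fin d) (Fin d) ℝ →ₗ[ℝ] ℝ :=
    Matrix.traceLinearMap (Fin d) ℝ ℝ ∘ₗ LinearMap.mulLeft ℝ S₀
  have hℓ₁ : ∀ M, ℓ₁ M = inner ℝ v (M.toEuclideanLin v) := fun M => rfl
  have hℓ₂ : ∀ M, ℓ₂ M = (S₀ * M).trace := fun M => rfl
  let e : ℝ → ℝ := fun t => ℓ₁ (cfc (fun a => t * Real.exp (2 * t * a)) A) +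
    kappa d g * ℓ₂ (cfc (fun a => a ^ 2 * (t * Real.exp (2 * t * a))) A)
  have hval : ∀ t ∈ Set.Icc (0 : ℝ) 1, 0 ≤ e t ∧
      ENNReal.ofReal t * ottoNormSq (γ t) f = ENNReal.ofReal (e t) := by
    intro t ht
    have hsc : ∀ F : ℝ → ℝ, cfc (fun a => t * F a) A = t • cfc F A := fun F =>
      cfc_const_mul t F A (continuousOn_spectrum A F)
    have h1 : ‖A.toEuclideanLin (m t) + b‖ ^ 2 =
        ℓ₁ (cfc (fun a => Real.exp (2 * t * a)) A) := by
      rw [hm t ht, norm_toEuclideanLin_sq, transpose_flow, flow_mul_flow, hℓ₁, flow, ← two_mul]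
    have h2 : (A * S t * Aᵀ).trace = ℓ₂ (cfc (fun a => a ^ 2 * Real.exp (2 * t * a)) A) := by
      rw [hS t ht, transpose_eq hA, hℓ₂]
      have hc : cfc (fun a => a ^ 2 * Real.exp (2 * t * a)) A =
          (flow A t * A) * (A * flow A t) := by
        rw [flow_mul hA, mul_flow hA, cfc_mul_cfc]
        refine cfc_congr fun a _ => ?_
        have : Real.exp (2 * t * a) = Real.exp (t * a) * Real.exp (t * a) := by
          rw [← Real.exp_add]; ring_nf
        simp only [this]; ring
      calc (A * (flow A t * S₀ * flow A t) * A).trace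
          = ((A * flow A t) * (S₀ * (flow A t * A))).trace := by simp only [Matrix.mul_assoc]
        _ = (S₀ * ((flow A t * A) * (A * flow A t))).trace := by
          rw [Matrix.trace_mul_comm, Matrix.mul_assoc]
        _ = _ := by rw [hc]
    have h3 : e t = t * (‖A.toEuclideanLin (m t) + b‖ ^ 2 +
        kappa d g * (A * S t * Aᵀ).trace) := by
      have hsc2 : (fun a => a ^ 2 * (t * Real.exp (2 * t * a))) =
          fun a => t * (a ^ 2 * Real.exp (2 * t * a)) := by funext a; ring
      simp only [e, hsc2, hsc, map_smul, smul_eq_mul, h1, h2]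
      ring
    have hnn : 0 ≤ ‖A.toEuclideanLin (m t) + b‖ ^ 2 + kappa d g * (A * S t * Aᵀ).trace :=
      add_nonneg (sq_nonneg _) (mul_nonneg (kappa_pos hd hg).le
        (trace_mul_mul_transpose_nonneg (hmem t ht).1 A))
    refine ⟨by rw [h3]; exact mul_nonneg ht.1 hnn, ?_⟩
    rw [(hmem t ht).2, ottoNormSq_elliptic_affine hd hg (hmem t ht).1 hf, h3,
      ENNReal.ofReal_mul ht.1]
  have hc1 : Continuous fun t => ℓ₁ (cfc (fun a => t * Real.exp (2 * t * a)) A) :=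
    continuous_linearMap_cfc hA ℓ₁ fun a _ => by fun_prop
  have hc2 : Continuous fun t => ℓ₂ (cfc (fun a => a ^ 2 * (t * Real.exp (2 * t * a))) A) :=
    continuous_linearMap_cfc hA ℓ₂ fun a _ => by fun_prop
  have hc3 : Continuous fun t =>
      kappa d g * ℓ₂ (cfc (fun a => a ^ 2 * (t * Real.exp (2 * t * a))) A) :=
    continuous_const.mul hc2
  have hcont : Continuous e := hc1.add hc3
  rw [setLIntegral_congr_fun measurableSet_Icc fun t ht => (hval t ht).2,
    ← ofReal_integral_eq_lintegral_ofReal (hcont.integrableOn_Icc)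
      ((ae_restrict_iff' measurableSet_Icc).2
        (Filter.Eventually.of_forall fun t ht => (hval t ht).1)),
    integral_Icc_eq_integral_Ioc, ← intervalIntegral.integral_of_le zero_le_one,
    intervalIntegral.integral_add (hc1.intervalIntegrable _ _)
      (hc3.intervalIntegrable _ _),
    intervalIntegral.integral_const_mul,
    linearMap_cfc_intervalIntegral hA ℓ₁ fun a _ =>
      Continuous.intervalIntegrable (by fun_prop) _ _,
    linearMap_cfc_intervalIntegral hA ℓ₂ fun a _ =>
      Continuous.intervalIntegrable (by fun_prop) _ _]
  simp_rw [intervalIntegral.integral_const_mul, hℓ₁, hℓ₂]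
  rfl

end Energy

/-! ### Closed forms -/

section ClosedForms

variable {d : ℕ} {A : Matrix (Fin d) (Fin d) ℝ}

theorem flow_one (A : Matrix (Fin d) (Fin d) ℝ) : flow A 1 = cfc Real.exp A := by
  simp [flow]

theorem logm_flow_one (hA : A.IsHermitian) : logm (flow A 1) = A := by
  rw [flow_one, logm, cfc_cfc _ _ hA]
  simp_rw [Real.log_exp]
  exact cfc_id_eq hA

theorem flow_logm_one {R : Matrix (Fin d) (Fin d) ℝ} (hR : R.PosDef) : flow (logm R) 1 = R := by
  rw [flow_one, logm, cfc_cfc _ _ hR.1]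
  conv_rhs => rw [← cfc_id_eq hR.1]
  exact cfc_congr fun x hx => Real.exp_log ((posDef_iff_spectrum_pos.1 hR).2 x hx)

theorem flow_one_sq (A : Matrix (Fin d) (Fin d) ℝ) :
    flow A 1 ^ 2 = cfc (fun a => Real.exp (2 * a)) A := by
  rw [sq, flow_mul_flow, one_add_one_eq_two, flow]

theorem logm_flow_one_sq (hA : A.IsHermitian) :
    logm (flow A 1 ^ 2) = cfc (fun a : ℝ => 2 * a) A := by
  rw [flow_one_sq, logm, cfc_cfc _ _ hA]
  simp_rw [Real.log_exp]

/-- The scalar function of `log R` that gives `Q`. -/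
def qWeight (a : ℝ) : ℝ :=
  (Real.exp a - 1)⁻¹ * (2 * a * Real.exp (2 * a) - Real.exp (2 * a) + 1) * (Real.exp a - 1)⁻¹

theorem log_mul_sq_sub_sq_add_one (hA : A.IsHermitian) :
    logm (flow A 1 ^ 2) * flow A 1 ^ 2 - flow A 1 ^ 2 + 1 =
      cfc (fun a => 2 * a * Real.exp (2 * a) - Real.exp (2 * a) + 1) A := by
  rw [logm_flow_one_sq hA, flow_one_sq, cfc_mul_cfc, cfc_sub_cfc, ← cfc_const_one_eq hA,
    cfc_add_cfc]

theorem flow_one_sub_one (hA : A.IsHermitian) :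
    flow A 1 - 1 = cfc (fun a => Real.exp a - 1) A := by
  rw [flow_one, ← cfc_const_one_eq hA, cfc_sub_cfc]

theorem qMatrix_flow_one (hA : A.IsHermitian) : qMatrix (flow A 1) = cfc qWeight A := by
  rw [qMatrix, log_mul_sq_sub_sq_add_one hA, flow_one_sub_one hA, pinv, cfc_cfc _ _ hA,
    cfc_mul_cfc, cfc_mul_cfc]
  rfl

theorem perp_eq_cfc (hA : A.IsHermitian) : perp A = cfc (fun a : ℝ => 1 - a * a⁻¹) A := by
  rw [perp, pinv]
  conv_lhs => rw [← cfc_id_eq hA]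
  rw [cfc_cfc _ _ hA, cfc_mul_cfc, ← cfc_const_one_eq hA, cfc_sub_cfc]

theorem qMatrix_add_two_perp (hA : A.IsHermitian) :
    qMatrix (flow A 1) + 2 • perp (logm (flow A 1)) =
      cfc (fun a => qWeight a + (1 - a * a⁻¹ + (1 - a * a⁻¹))) A := by
  rw [logm_flow_one hA, qMatrix_flow_one hA, perp_eq_cfc hA, two_smul, cfc_add_cfc, cfc_add_cfc]

theorem exp_sub_one_ne_zero {a : ℝ} (ha : a ≠ 0) : Real.exp a - 1 ≠ 0 :=
  sub_ne_zero.2 fun h => ha ((Real.exp_eq_one_iff a).1 h)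

theorem qWeight_mul_sq (a : ℝ) :
    qWeight a * (Real.exp a - 1) ^ 2 = 4 * (a ^ 2 * expMoment a) := by
  by_cases ha : a = 0
  · simp [ha]
  · have := exp_sub_one_ne_zero ha
    rw [sq_mul_expMoment, qWeight]
    field_simp

/-- Off the kernel the projection term vanishes and the factor `(exp a - 1) / a` cancels the
inverses in `qWeight`. At `a = 0` the convention `0⁻¹ = 0` kills `qWeight`, and the projection
contributes `2 = 4 · 1/2`. -/
theorem sq_expIntegral_mul_weight (a : ℝ) :
    expIntegral 1 a ^ 2 * (qWeight a + (1 - a * a⁻¹ + (1 - a * a⁻¹))) = 4 * expMoment a := by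
  by_cases ha : a = 0
  · simp [ha, expIntegral, qWeight, expMoment_zero]
    norm_num
  · have h := qWeight_mul_sq a
    rw [mul_inv_cancel₀ ha, sub_self, add_zero, add_zero]
    simp only [expIntegral, ha, if_false, one_mul]
    field_simp
    linarith

theorem expMoment_nonneg (a : ℝ) : 0 ≤ expMoment a :=
  intervalIntegral.integral_nonneg zero_le_one fun _ ht => mul_nonneg ht.1 (Real.exp_pos _).le

/-- Read off from the previous identity, whose right-hand side is the integral of a nonnegative
function. It makes the square root in the drift term genuine. -/
theorem weight_nonneg (a : ℝ) : 0 ≤ qWeight a + (1 - a * a⁻¹ + (1 - a * a⁻¹)) := by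
  have h := sq_expIntegral_mul_weight a
  have h1 : 0 < expIntegral 1 a ^ 2 := by
    have := expIntegral_one_ne_zero a
    positivity
  have h2 := expMoment_nonneg a
  exact nonneg_of_mul_nonneg_right (by rw [h]; linarith) h1

theorem qWeight_nonneg (a : ℝ) : 0 ≤ qWeight a := by
  by_cases ha : a = 0
  · simp [ha, qWeight]
  · have h := weight_nonneg a
    rwa [mul_inv_cancel₀ ha, sub_self, add_zero, add_zero] at h

theorem mulVecNorm_sqrtm_sq {C : Matrix (Fin d) (Fin d) ℝ} (hC : C.PosSemidef)
    (x : EuclideanSpace ℝ (Fin d)) :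
    mulVecNorm (sqrtm C) x ^ 2 = inner ℝ x (C.toEuclideanLin x) := by
  rw [mulVecNorm, norm_toEuclideanLin_sq, sqrtm, transpose_cfc, ← sqrtm, sqrtm_mul_self hC]

/-- The drift contribution to the divergence. -/
theorem mulVecNorm_flowIntegral_sq (hA : A.IsHermitian) (v : EuclideanSpace ℝ (Fin d)) :
    1 / 4 * mulVecNorm (sqrtm (qMatrix (flow A 1) + 2 • perp (logm (flow A 1))))
      ((flowIntegral A 1).toEuclideanLin v) ^ 2 =
    inner ℝ v ((cfc expMoment A).toEuclideanLin v) := by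
  rw [qMatrix_add_two_perp hA, mulVecNorm_sqrtm_sq (posSemidef_cfc hA fun a _ => weight_nonneg a),
    inner_toEuclideanLin_left, flowIntegral, transpose_cfc, ← toEuclideanLin_mul_apply,
    ← toEuclideanLin_mul_apply, cfc_mul_cfc, cfc_mul_cfc]
  have h : (fun a => expIntegral 1 a * (qWeight a + (1 - a * a⁻¹ + (1 - a * a⁻¹))) *
      expIntegral 1 a) = fun a => 4 * expMoment a := by
    funext a
    rw [← sq_expIntegral_mul_weight]
    ring
  rw [h, cfc_const_mul 4 expMoment A (continuousOn_spectrum A _), map_smul, LinearMap.smul_apply,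
    inner_smul_right]
  ring

/-- The scatter contribution to the divergence. -/
theorem trace_scatter (hA : A.IsHermitian) (S₀ : Matrix (Fin d) (Fin d) ℝ) :
    (S₀ - flow A 1 * S₀ * flow A 1 + S₀ * flow A 1 ^ 2 * logm (flow A 1 ^ 2)).trace =
      4 * (S₀ * cfc (fun a => a ^ 2 * expMoment a) A).trace := by
  have h1 : cfc (fun a => a ^ 2 * expMoment a) A =
      (4 : ℝ)⁻¹ • (logm (flow A 1 ^ 2) * flow A 1 ^ 2 - flow A 1 ^ 2 + 1) := by
    rw [log_mul_sq_sub_sq_add_one hA,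
      ← cfc_const_mul (4 : ℝ)⁻¹ _ A (continuousOn_spectrum A _)]
    refine cfc_congr fun a _ => ?_
    simp only [sq_mul_expMoment]
    ring
  have h2 : (flow A 1 * S₀ * flow A 1).trace = (S₀ * flow A 1 ^ 2).trace := by
    rw [Matrix.trace_mul_comm, ← Matrix.mul_assoc, Matrix.trace_mul_comm, sq]
  have h3 : flow A 1 ^ 2 * logm (flow A 1 ^ 2) = logm (flow A 1 ^ 2) * flow A 1 ^ 2 := by
    rw [logm_flow_one_sq hA, flow_one_sq, cfc_mul_cfc, cfc_mul_cfc]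
    simp_rw [mul_comm]
  rw [h1, Matrix.mul_smul, Matrix.trace_smul, Matrix.mul_add, Matrix.mul_sub, Matrix.trace_add,
    Matrix.trace_sub, Matrix.trace_add, Matrix.trace_sub, h2, Matrix.mul_assoc S₀, h3,
    Matrix.mul_one, smul_eq_mul]
  ring

theorem trace_mul_cfc_nonneg {S₀ : Matrix (Fin d) (Fin d) ℝ} (h₀ : S₀.PosDef) {F : ℝ → ℝ}
    (hF : ∀ a, 0 ≤ F a) : 0 ≤ (S₀ * cfc F A).trace := by
  have h := trace_mul_mul_transpose_nonneg h₀ (cfc (fun a => √(F a)) A)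
  rw [transpose_cfc, Matrix.mul_assoc, Matrix.trace_mul_comm, Matrix.mul_assoc, cfc_mul_cfc] at h
  simpa only [Real.mul_self_sqrt (hF _)] using h

theorem frobeniusNorm_sq (B : Matrix (Fin d) (Fin d) ℝ) :
    frobeniusNorm B ^ 2 = (B * Bᵀ).trace := by
  have h : 0 ≤ ∑ i, ∑ j, B i j ^ 2 :=
    Finset.sum_nonneg fun i _ => Finset.sum_nonneg fun j _ => sq_nonneg _
  rw [frobeniusNorm, Real.sq_sqrt h]
  simp [Matrix.trace, Matrix.mul_apply, sq]

theorem commute_cfc_cfc {S T : Matrix (Fin d) (Fin d) ℝ} (h : Commute S T) (φ ψ : ℝ → ℝ) :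
    Commute (cfc φ S) (cfc ψ T) :=
  ((h.cfc_real φ).symm.cfc_real ψ).symm

/-- For commuting scatter matrices the transport matrix is `S₁^{1/2} S₀^{-1/2}`. -/
theorem transportMatrix_mul_sqrtm {S₀ S₁ : Matrix (Fin d) (Fin d) ℝ} (h₀ : S₀.PosDef)
    (h₁ : S₁.PosDef) (h : Commute S₀ S₁) :
    transportMatrix S₀ S₁ * sqrtm S₀ = sqrtm S₁ ∧
      sqrtm S₀ * transportMatrix S₀ S₁ = sqrtm S₁ := by
  -- `H = S₀^{-1/4}`: the symmetric form `H √S₁ H` of `√S₁ S₀^{-1/2}` is visibly positive definite,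
  -- as the uniqueness of `R` requires.
  set H := cfc (fun x : ℝ => (√√x)⁻¹) S₀ with hH
  have hspec := (posDef_iff_spectrum_pos.1 h₀).2
  have hHpos : H.PosDef := posDef_cfc h₀.1 fun x hx =>
    inv_pos.2 (Real.sqrt_pos.2 (Real.sqrt_pos.2 (hspec x hx)))
  have hHL : H * sqrtm S₁ = sqrtm S₁ * H := commute_cfc_cfc h _ _
  have hHH : H * H * sqrtm S₀ = 1 ∧ sqrtm S₀ * (H * H) = 1 := by
    have e : ∀ x ∈ spectrum ℝ S₀, (√√x)⁻¹ * (√√x)⁻¹ * √x = 1 := by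
      intro x hx
      have hx' := Real.sqrt_pos.2 (hspec x hx)
      rw [← mul_inv, Real.mul_self_sqrt hx'.le, inv_mul_cancel₀ hx'.ne']
    constructor
    · rw [hH, sqrtm, cfc_mul_cfc, cfc_mul_cfc, ← cfc_const_one_eq h₀.1]
      exact cfc_congr e
    · rw [hH, sqrtm, cfc_mul_cfc, cfc_mul_cfc, ← cfc_const_one_eq h₀.1]
      exact cfc_congr fun x hx => by simpa only [mul_comm] using e x hx
  have hX1 : H * sqrtm S₁ * H * sqrtm S₀ = sqrtm S₁ := by
    rw [hHL, Matrix.mul_assoc, Matrix.mul_assoc, ← Matrix.mul_assoc H, hHH.1, Matrix.mul_one]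
  have hX2 : sqrtm S₀ * (H * sqrtm S₁ * H) = sqrtm S₁ := by
    rw [Matrix.mul_assoc, ← hHL, ← Matrix.mul_assoc H, ← Matrix.mul_assoc, hHH.2, Matrix.one_mul]
  have hX : H * sqrtm S₁ * H = transportMatrix S₀ S₁ := by
    refine eq_transportMatrix h₀ (posDef_mul_mul (posDef_sqrtm h₁) hHpos) ?_
    generalize H * sqrtm S₁ * H = X at hX1 hX2
    rw [← sqrtm_mul_self h₀.posSemidef, ← Matrix.mul_assoc, hX1, Matrix.mul_assoc, hX2,
      sqrtm_mul_self h₁.posSemidef]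
  rw [← hX]
  exact ⟨hX1, hX2⟩

/-- The scatter contribution to the divergence for commuting scatter matrices. -/
theorem frobeniusNorm_commuting (hA : A.IsHermitian) {S₀ S₁ : Matrix (Fin d) (Fin d) ℝ}
    (h₀ : S₀.PosDef) (h₁ : S₁.PosDef) (h : Commute S₀ S₁)
    (hR : flow A 1 = transportMatrix S₀ S₁) :
    frobeniusNorm (sqrtm (qMatrix (flow A 1)) * (sqrtm S₁ - sqrtm S₀)) ^ 2 =
      4 * (S₀ * cfc (fun a => a ^ 2 * expMoment a) A).trace := by
  obtain ⟨e1, e2⟩ := transportMatrix_mul_sqrtm h₀ h₁ h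
  rw [← hR] at e1 e2
  have hQ : (qMatrix (flow A 1)).PosSemidef := by
    rw [qMatrix_flow_one hA]
    exact posSemidef_cfc hA fun a _ => qWeight_nonneg a
  have hQt : (sqrtm (qMatrix (flow A 1)))ᵀ = sqrtm (qMatrix (flow A 1)) := transpose_cfc _ _
  have hDt : (sqrtm S₁ - sqrtm S₀)ᵀ = sqrtm S₁ - sqrtm S₀ := by
    rw [Matrix.transpose_sub, sqrtm, sqrtm, transpose_cfc, transpose_cfc]
  -- Factoring `R - I` out on either side gives the square `(R - I) S₀ (R - I)`, whose outer factors
  -- cancel the pseudo-inverses in `Q` under the trace.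
  have f1 : sqrtm S₁ - sqrtm S₀ = (flow A 1 - 1) * sqrtm S₀ := by
    rw [Matrix.sub_mul, e1, Matrix.one_mul]
  have f2 : sqrtm S₁ - sqrtm S₀ = sqrtm S₀ * (flow A 1 - 1) := by
    rw [Matrix.mul_sub, e2, Matrix.mul_one]
  have f3 : (sqrtm S₁ - sqrtm S₀) * (sqrtm S₁ - sqrtm S₀) =
      (flow A 1 - 1) * S₀ * (flow A 1 - 1) := by
    nth_rewrite 1 [f1]
    rw [f2, Matrix.mul_assoc, ← Matrix.mul_assoc (sqrtm S₀), sqrtm_mul_self h₀.posSemidef,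
      Matrix.mul_assoc]
  rw [frobeniusNorm_sq, Matrix.transpose_mul, hQt, hDt]
  calc (sqrtm (qMatrix (flow A 1)) * (sqrtm S₁ - sqrtm S₀) *
        ((sqrtm S₁ - sqrtm S₀) * sqrtm (qMatrix (flow A 1)))).trace
      = (sqrtm (qMatrix (flow A 1)) * (((sqrtm S₁ - sqrtm S₀) * (sqrtm S₁ - sqrtm S₀)) *
          sqrtm (qMatrix (flow A 1)))).trace := by simp only [Matrix.mul_assoc]
    _ = ((flow A 1 - 1) * S₀ * (flow A 1 - 1) * qMatrix (flow A 1)).trace := by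
        rw [Matrix.trace_mul_comm, f3, Matrix.mul_assoc, sqrtm_mul_self hQ]
    _ = (S₀ * ((flow A 1 - 1) * qMatrix (flow A 1) * (flow A 1 - 1))).trace := by
        rw [Matrix.mul_assoc, Matrix.mul_assoc, Matrix.trace_mul_comm]
        simp only [Matrix.mul_assoc]
    _ = (S₀ * cfc (fun a => 4 * (a ^ 2 * expMoment a)) A).trace := by
        rw [qMatrix_flow_one hA, flow_one_sub_one hA, cfc_mul_cfc, cfc_mul_cfc]
        congr 2
        refine cfc_congr fun a _ => ?_
        simp only [← qWeight_mul_sq]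
        ring
    _ = 4 * (S₀ * cfc (fun a => a ^ 2 * expMoment a) A).trace := by
        rw [cfc_const_mul 4 _ A (continuousOn_spectrum A _), Matrix.mul_smul, Matrix.trace_smul,
          smul_eq_mul]

end ClosedForms

/-! ### The divergence -/

section Divergence

variable {d : ℕ} {g : ℝ → ℝ} {A : Matrix (Fin d) (Fin d) ℝ}

theorem flowIntegral_one_injective (hA : A.IsHermitian) (v : EuclideanSpace ℝ (Fin d)) :
    (cfc (fun a => (expIntegral 1 a)⁻¹) A).toEuclideanLin
      ((flowIntegral A 1).toEuclideanLin v) = v := by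
  rw [← toEuclideanLin_mul_apply, flowIntegral, cfc_mul_cfc]
  simp_rw [inv_mul_cancel₀ (expIntegral_one_ne_zero _)]
  rw [cfc_const_one_eq hA, toEuclideanLin_one_apply]

theorem flowIntegral_one_surjective (hA : A.IsHermitian) (w : EuclideanSpace ℝ (Fin d)) :
    ∃ v, (flowIntegral A 1).toEuclideanLin v = w := by
  refine ⟨(cfc (fun a => (expIntegral 1 a)⁻¹) A).toEuclideanLin w, ?_⟩
  rw [← toEuclideanLin_mul_apply, flowIntegral, cfc_mul_cfc]
  simp_rw [mul_inv_cancel₀ (expIntegral_one_ne_zero _)]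
  rw [cfc_const_one_eq hA, toEuclideanLin_one_apply]

theorem contDiff_matrix_mul_apply {S T : ℝ → Matrix (Fin d) (Fin d) ℝ}
    (hS : ∀ i j, ContDiff ℝ ∞ fun t => S t i j) (hT : ∀ i j, ContDiff ℝ ∞ fun t => T t i j)
    (i j : Fin d) : ContDiff ℝ ∞ fun t => (S t * T t) i j := by
  simp only [Matrix.mul_apply]
  exact ContDiff.sum fun k _ => (hS i k).mul (hT k j)

/-- The flow of an affine gradient field moves elliptic densities along a dual geodesic. -/
theorem exists_dualGeodesic (hd : 0 < d) (hg : IsEllipticGenerator d g) (hA : A.IsHermitian)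
    {S₀ : Matrix (Fin d) (Fin d) ℝ} (h₀ : S₀.PosDef) (m₀ v : EuclideanSpace ℝ (Fin d)) :
    ∃ γ ∈ ellipticCurves d g, ∃ f, IsDualGeodesic γ f ∧ γ 0 = ellipticDensity m₀ S₀ g ∧
      γ 1 = ellipticDensity (m₀ + (flowIntegral A 1).toEuclideanLin v)
        (flow A 1 * S₀ * flow A 1) g ∧
      ∫⁻ t in Set.Icc (0 : ℝ) 1, ENNReal.ofReal t * ottoNormSq (γ t) f =
        ENNReal.ofReal (inner ℝ v ((cfc expMoment A).toEuclideanLin v) +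
          kappa d g * (S₀ * cfc (fun a => a ^ 2 * expMoment a) A).trace) := by
  let m : ℝ → EuclideanSpace ℝ (Fin d) := fun t => m₀ + (flowIntegral A t).toEuclideanLin v
  let S : ℝ → Matrix (Fin d) (Fin d) ℝ := fun t => flow A t * S₀ * flow A t
  -- Chosen so that the location starts with velocity `v`.
  let b : EuclideanSpace ℝ (Fin d) := v - A.toEuclideanLin m₀
  have hAt := transpose_eq hA
  have hpos : ∀ t, (S t).PosDef := fun t => posDef_mul_mul h₀ (posDef_flow hA t)
  have hmb : ∀ t, A.toEuclideanLin (m t) + b = (flow A t).toEuclideanLin v := by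
    intro t
    simp only [m, b, map_add, ← toEuclideanLin_mul_apply, mul_flowIntegral hA, map_sub,
      LinearMap.sub_apply, toEuclideanLin_one_apply]
    abel
  have hf := gradient_quadPotential hAt b
  refine ⟨fun t => ellipticDensity (m t) (S t) g, ⟨m, S, ?_, ?_, fun t _ => ⟨hpos t, rfl⟩⟩,
    quadPotential A b, ⟨fun t _ => ellipticDensity_mem_densityManifold hd hg (hpos t),
      contDiff_quadPotential A b, fun t ht x => ?_⟩, ?_, rfl,
    lintegral_energy hd hg hA (fun t _ => ⟨hpos t, rfl⟩) hf (fun t _ => rfl)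
      fun t _ => hmb t⟩
  · refine ContDiff.contDiffOn (contDiff_const.add ?_)
    rw [contDiff_euclidean]
    intro i
    simp only [Matrix.ofLp_toLpLin, Matrix.toLin'_apply, Matrix.mulVec, dotProduct]
    exact ContDiff.sum fun k _ => (contDiff_flowIntegral_apply hA i k).mul contDiff_const
  · intro i j
    exact (contDiff_matrix_mul_apply (contDiff_matrix_mul_apply (T := fun _ => S₀)
      (contDiff_flow_apply hA) fun _ _ => contDiff_const) (contDiff_flow_apply hA) i j).contDiffOn
  · refine hasDerivWithinAt_ellipticDensity hg ht (uniqueDiffOn_Icc zero_lt_one t ht)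
      (fun τ _ => hpos τ) hAt ?_ ?_ x
    · rw [hmb]
      refine (((hasMatrixDerivWithinAt_flowIntegral hA _ t).toEuclideanLin_apply
        (hasDerivWithinAt_const t _ v)).const_add m₀).congr_deriv ?_
      rw [map_zero, add_zero]
    · have hfl := hasMatrixDerivWithinAt_flow hA (Set.Icc 0 1) t
      have h := (hfl.mul (hasMatrixDerivWithinAt_const S₀)).mul hfl
      intro i j
      refine (h i j).congr_deriv ?_
      simp only [S, Matrix.mul_zero, add_zero, Matrix.mul_assoc, flow_mul hA]
  · simp only [m, S, flowIntegral_zero, flow_zero hA, map_zero, LinearMap.zero_apply, add_zero,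
      Matrix.one_mul, Matrix.mul_one]

/-- The divergence in terms of the initial velocity `v` and the generator `A` of the flow. -/
theorem wklDivergence_eq (hd : 0 < d) (hg : IsEllipticGenerator d g)
    {S₀ S₁ : Matrix (Fin d) (Fin d) ℝ} (h₀ : S₀.PosDef) (h₁ : S₁.PosDef)
    {m₀ m₁ v : EuclideanSpace ℝ (Fin d)} (hA : A.IsHermitian)
    (hR : flow A 1 = transportMatrix S₀ S₁)
    (hv : (flowIntegral A 1).toEuclideanLin v = m₁ - m₀) :
    wklDivergence g (toMeasure (ellipticDensity m₀ S₀ g))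
        (toMeasure (ellipticDensity m₁ S₁ g)) =
      ENNReal.ofReal (inner ℝ v ((cfc expMoment A).toEuclideanLin v) +
        kappa d g * (S₀ * cfc (fun a => a ^ 2 * expMoment a) A).trace) := by
  refine le_antisymm (sInf_le ?_) (le_sInf ?_)
  · obtain ⟨γ, hγ, f, hf, e0, e1, he⟩ := exists_dualGeodesic hd hg hA h₀ m₀ v
    rw [hR, transportMatrix_mul_mul h₀ h₁, hv, add_sub_cancel] at e1
    exact ⟨γ, hγ, f, hf, by rw [e0], by rw [e1], he.symm⟩
  · rintro a ⟨γ, ⟨m, S, hm, hS, hmem⟩, f, hf, e0, e1, rfl⟩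
    -- Potentials of infinite energy escape the rigidity argument but cannot lower the infimum.
    by_cases hfin : ∫⁻ t in Set.Icc (0 : ℝ) 1, ENNReal.ofReal t * ottoNormSq (γ t) f = ⊤
    · rw [hfin]; exact le_top
    obtain ⟨A', b, hA', hgrad, hode⟩ := hf.exists_affine hd hg hm hS hmem hfin
    have hA'h : A'.IsHermitian := by
      rw [Matrix.IsHermitian, Matrix.conjTranspose_eq_transpose_of_trivial, hA']
    have t0 : (0 : ℝ) ∈ Set.Icc (0 : ℝ) 1 := ⟨le_rfl, zero_le_one⟩
    have t1 : (1 : ℝ) ∈ Set.Icc (0 : ℝ) 1 := ⟨zero_le_one, le_rfl⟩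
    rw [(hmem 0 t0).2] at e0
    rw [(hmem 1 t1).2] at e1
    obtain ⟨hm0, hS0⟩ := elliptic_injective hd hg (hmem 0 t0).1 h₀ e0
    obtain ⟨hm1, hS1⟩ := elliptic_injective hd hg (hmem 1 t1).1 h₁ e1
    have hSt := fun t ht => eq_flow_mul_mul_flow (t := t) hA'h (fun t ht => (hode t ht).1) ht
    have hmt := fun t ht => affine_eq_flow (t := t) hA'h (fun t ht => (hode t ht).2) ht
    -- Both exponentials are positive definite and carry `S₀` to `S₁`, so they coincide, and the
    -- logarithm recovers the matrix.
    have hAA : A' = A := by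
      have h := hSt 1 t1
      rw [hS0, hS1] at h
      rw [← logm_flow_one hA'h, ← logm_flow_one hA, hR,
        ← eq_transportMatrix h₀ (posDef_flow hA'h 1) h.symm]
    subst hAA
    have hvv : A'.toEuclideanLin (m 0) + b = v := by
      have h := eq_add_flowIntegral hA'h (fun t ht => (hode t ht).2) t1
      rw [hm1, hm0] at h
      have h' : (flowIntegral A' 1).toEuclideanLin (A'.toEuclideanLin m₀ + b) =
          (flowIntegral A' 1).toEuclideanLin v := by
        rw [hv, h, add_sub_cancel_left]
      rw [hm0, ← flowIntegral_one_injective hA (A'.toEuclideanLin m₀ + b), h',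
        flowIntegral_one_injective hA]
    refine (lintegral_energy hd hg hA hmem hgrad (fun t ht => ?_) fun t ht => ?_).ge
    · rw [hSt t ht, hS0]
    · rw [hmt t ht, hvv]

end Divergence

end WKL

end

theorem mainTheorem2 {d : ℕ} (hd : 0 < d) (g : ℝ → ℝ)
    (m₀ m₁ : EuclideanSpace ℝ (Fin d)) (S₀ S₁ : Matrix (Fin d) (Fin d) ℝ)
    (μ ν : MeasureTheory.Measure (EuclideanSpace ℝ (Fin d)))
    (hμ : WKL.IsElliptic μ m₀ S₀ g) (hν : WKL.IsElliptic ν m₁ S₁ g)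
    (R Q : Matrix (Fin d) (Fin d) ℝ)
    (hR : R = WKL.transportMatrix S₀ S₁) (hQ : Q = WKL.qMatrix R) :
    WKL.wklDivergence g μ ν ≠ ⊤ ∧
    (WKL.wklDivergence g μ ν).toReal =
      WKL.kappa d g / 4 * (S₀ - S₁ + S₀ * R ^ 2 * WKL.logm (R ^ 2)).trace +
      1 / 4 * WKL.mulVecNorm (WKL.sqrtm (Q + 2 • WKL.perp (WKL.logm R))) (m₁ - m₀) ^ 2 ∧
    (S₀ * S₁ = S₁ * S₀ →
      (WKL.wklDivergence g μ ν).toReal =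
        WKL.kappa d g / 4 *
          WKL.frobeniusNorm (WKL.sqrtm Q * (WKL.sqrtm S₁ - WKL.sqrtm S₀)) ^ 2 +
        1 / 4 * WKL.mulVecNorm (WKL.sqrtm (Q + 2 • WKL.perp (WKL.logm R))) (m₁ - m₀) ^ 2) := by
  have hg := hμ.generator
  have h₀ := hμ.posDef
  have h₁ := hν.posDef
  have hRpos : R.PosDef := by
    rw [hR]
    exact WKL.posDef_transportMatrix h₀ h₁
  -- Writing `R = exp A` turns `R`, `log R` and `Q` into functions of the single symmetric matrix
  -- `A`.
  obtain ⟨A, hA, hAR⟩ : ∃ A : Matrix (Fin d) (Fin d) ℝ, A.IsHermitian ∧ WKL.flow A 1 = R :=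
    ⟨WKL.logm R, WKL.isHermitian_cfc _ _, WKL.flow_logm_one hRpos⟩
  obtain ⟨v, hv⟩ := WKL.flowIntegral_one_surjective hA (m₁ - m₀)
  have hdiv := WKL.wklDivergence_eq hd hg h₀ h₁ hA (hAR.trans hR) hv
  rw [← hμ.eq_density, ← hν.eq_density] at hdiv
  have hdrift := WKL.mulVecNorm_flowIntegral_sq hA v
  have hscatter := WKL.trace_scatter hA S₀
  have hS₁ : WKL.flow A 1 * S₀ * WKL.flow A 1 = S₁ := by
    rw [hAR, hR, WKL.transportMatrix_mul_mul h₀ h₁]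
  have hcomm := fun h : S₀ * S₁ = S₁ * S₀ =>
    WKL.frobeniusNorm_commuting hA h₀ h₁ h (hAR.trans hR)
  rw [hS₁] at hscatter
  rw [hv] at hdrift
  rw [hAR] at hscatter hdrift hcomm
  rw [← hQ] at hdrift hcomm
  have hnn : 0 ≤ inner ℝ v ((cfc WKL.expMoment A).toEuclideanLin v) +
      WKL.kappa d g * (S₀ * cfc (fun a => a ^ 2 * WKL.expMoment a) A).trace := by
    refine add_nonneg (by rw [← hdrift]; positivity) (mul_nonneg (WKL.kappa_pos hd hg).le ?_)
    exact WKL.trace_mul_cfc_nonneg h₀ fun a => mul_nonneg (sq_nonneg a) (WKL.expMoment_nonneg a)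
  rw [hdiv, ENNReal.toReal_ofReal hnn]
  refine ⟨ENNReal.ofReal_ne_top, ?_, fun h => ?_⟩
  · rw [hdrift, hscatter]; ring
  · rw [hdrift, hcomm h]; ring
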